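/- **Setting.** Let $R$ be a commutative $\mathbb{Q}$-algebra ("functions of the times $t_1=x,t_2,t_3,\dots$") with commuting derivations $\partial_n=\partial/\partial t_n$, $n\ge 1$, $\partial_x=\partial_1$. For invertible $f\in R$ put $\partial_x\partial_{t_r}\ln f:=\partial_x\big((\partial_r f)/f\big)$. Let $D$ be the symbol of the ring of formal pseudo-differential operators over $R$, $D^p f=\sum_{i\ge 0}\binom{p}{i}(\partial_x^i f)D^{p-i}$ for $p\in\mathbb{Z}$; $A_+$ and $A_-$ denote the parts of $A$ with non-negative and negative powers of $D$, and $\mathrm{Res}\,A$ the coefficient of $D^{-1}$. Fix $r\ge 1$. A solution of $\mathsf{cKP}_{r,2}$ consists of an invertible $\tau$ and of functions $\Phi_1,\Phi_2,\Psi_1,\Psi_2$ such that, with $W=\sum_{n\ge 0}\frac{p_n(-[\partial])\tau}{\tau}D^{-n}$ (where $[\partial]=(\partial_1,\frac12\partial_2,\frac13\partial_3,\dots)$ and $\sum_n\lambda^n p_n(t)=e^{\sum_{l\ge1}\lambda^l t_l}$), $L=WD^rW^{-1}$ and $L^{n/r}=WD^nW^{-1}$, one has for all $n\ge1$ $$\partial_n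 W=-(L^{n/r})_-W,\quad L_-=\sum_{i=1}^2\Phi_iD^{-1}\Psi_i,\quad \partial_n\Phi_i=(L^{n/r})_+(\Phi_i),\quad \partial_n\Psi_i=-\big((L^{n/r})_+\big)^*(\Psi_i).$$ A squared eigenfunction potential $S(\Phi,\Psi)$ is a function with $\partial_nS(\Phi,\Psi)=\mathrm{Res}\big(D^{-1}\Psi (L^{n/r})_+\Phi D^{-1}\big)$ for all $n\ge1$ (it is determined up to a constant). *Darboux–Bäcklund (DB) step with respect to $\Phi_1$* (requires $\Phi_1$ invertible), with $T=\Phi_1D\Phi_1^{-1}$: $W\mapsto TWD^{-1}$ (so $L\mapsto TLT^{-1}$), $\Phi_1\mapsto T(L(\Phi_1))$, $\Psi_1\mapsto 1/\Phi_1$, $\Phi_2\mapsto T(\Phi_2)$, $\Psi_2\mapsto -S(\Phi_1,\Psi_2)/\Phi_1$, $\tau\mapsto\Phi_1\tau$, where $L(\Phi_1)=L_+(\Phi_1)+\sum_i\Phi_iS(\Phi_1,\Psi_i)$ and $T(f)=\Phi_1\partial_x(f/\Phi_1)$. *Adjoint DB step with respect to $\Psi_2$* (requires $\Psi_2$ invertible),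 with $\bar T=\Psi_2D\Psi_2^{-1}$: $W\mapsto \Psi_2^{-1}D^{-1}\Psi_2WD$ (so $L\mapsto \bar T^{*-1}L\bar T^*$), $\Phi_2\mapsto-1/\Psi_2$, $\Psi_2\mapsto\bar T(L^*(\Psi_2))$, $\Phi_1\mapsto-S(\Phi_1,\Psi_2)/\Psi_2$, $\Psi_1\mapsto\bar T(\Psi_1)$, $\tau\mapsto\Psi_2\tau$, where $L^*(\Psi_2)=(L_+)^*(\Psi_2)-\sum_i\Psi_iS(\Phi_i,\Psi_2)$ and $\bar T(f)=\Psi_2\partial_x(f/\Psi_2)$. An *$(n,k)$ binary DB orbit* is a family of such data indexed by a set $\Omega\subseteq\mathbb{N}\times\mathbb{N}$ that is closed downwards ($\Omega=\mathbb{N}\times\mathbb{N}$ if the orbit does not terminate), together with squared eigenfunction potentials at its sites, such that the data at $(0,0)$ are a solution of $\mathsf{cKP}_{r,2}$, each step $(n,k)\to(n+1,k)$ inside $\Omega$ is the DB step, and each step $(n,k)\to(n,k+1)$ inside $\Omega$ is the adjoint DB step. (The additive constants of the potentials are thus normalised so that the result does not depend on the order of the steps.) **Statement.** On every $(n,k)$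 binary DB orbit of $\mathsf{cKP}_{r,2}$: 1. For all $(n,k)\in\Omega$, $\tau^{(n,k)}$ is invertible and $\partial_x\partial_{t_r}\ln\tau^{(n,k)}=\mathrm{Res}\,L^{(n,k)}=\Phi_1^{(n,k)}\Psi_1^{(n,k)}+\Phi_2^{(n,k)}\Psi_2^{(n,k)}$; if $n,k\ge1$, this equals $\dfrac{\Phi_1^{(n,k)}}{\Phi_1^{(n-1,k)}}-\dfrac{\Psi_2^{(n,k)}}{\Psi_2^{(n,k-1)}}$. Moreover $\Phi_1^{(n,k)}=\tau^{(n+1,k)}/\tau^{(n,k)}$ is invertible if $(n+1,k)\in\Omega$, and $\Psi_2^{(n,k)}=\tau^{(n,k+1)}/\tau^{(n,k)}$ is invertible if $(n,k+1)\in\Omega$. 2. (Toda square-lattice equation) For all $n,k\ge 1$ with $(n+1,k),(n,k+1)\in\Omega$, $$\partial_x\partial_{t_r}\ln\tau^{(n,k)}=\frac{\tau^{(n+1,k)}\tau^{(n-1,k)}-\tau^{(n,k+1)}\tau^{(n,k-1)}}{(\tau^{(n,k)})^2},$$ or, equivalently, $\tau^{(n,k)}\,\partial_x\partial_{t_r}\tau^{(n,k)}-\partial_x\tau^{(n,k)}\,\partial_{t_r}\tau^{(n,k)}=\tau^{(n+1,k)}\tau^{(n-1,k)}-\tau^{(n,k+1)}\tau^{(n,k-1)}$.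 3. (Coupled form) For all $n,k\ge1$ with $(n+1,k)\in\Omega$, $$\partial_x\partial_{t_r}\ln\Phi_1^{(n,k)}=\Big(\frac{\Phi_1^{(n+1,k)}}{\Phi_1^{(n,k)}}-\frac{\Phi_1^{(n,k)}}{\Phi_1^{(n-1,k)}}\Big)-\Big(\frac{\Psi_2^{(n+1,k)}}{\Psi_2^{(n+1,k-1)}}-\frac{\Psi_2^{(n,k)}}{\Psi_2^{(n,k-1)}}\Big),$$ and for all $n,k\ge1$ with $(n,k+1)\in\Omega$, $$\partial_x\partial_{t_r}\ln\Psi_2^{(n,k)}=-\Big(\frac{\Psi_2^{(n,k+1)}}{\Psi_2^{(n,k)}}-\frac{\Psi_2^{(n,k)}}{\Psi_2^{(n,k-1)}}\Big)+\Big(\frac{\Phi_1^{(n,k+1)}}{\Phi_1^{(n-1,k+1)}}-\frac{\Phi_1^{(n,k)}}{\Phi_1^{(n-1,k)}}\Big).$$ 4. (Equivalence) Let $\tau^{(n,k)}$, $n,k\ge0$, be any family of invertible elements of $R$, and put $\Phi_1^{(n,k)}=\tau^{(n+1,k)}/\tau^{(n,k)}$, $\Psi_2^{(n,k)}=\tau^{(n,k+1)}/\tau^{(n,k)}$.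 At every site with $n,k\ge1$ the two equations in 2 are equivalent; and the Toda equation holds at all sites $n,k\ge1$ if and only if it holds at $(1,1)$ and both coupled equations in 3 hold at all sites $n,k\ge1$. -/

import Mathlib

open scoped Ring

/-- Formal pseudo-differential operators `∑ₙ aₙ Dⁿ` (`n ∈ ℤ`, only finitely many `n > 0` with
`aₙ ≠ 0`) with coefficients in a commutative differential algebra `R`, coefficients on the left.
The derivation `d` is the one that `D` implements: `D f = f D + d f`. -/
@[ext]
structure PDO {R : Type*} [CommRing R] [Algebra ℚ R] (d : Derivation ℚ R R) where
  coeff : ℤ → R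
  bdd : ∃ N : ℤ, ∀ n, N < n → coeff n = 0

namespace PDO

variable {R : Type*} [CommRing R] [Algebra ℚ R] {d : Derivation ℚ R R}

instance : Zero (PDO d) := ⟨⟨fun _ => 0, 0, fun _ _ => rfl⟩⟩

instance : Add (PDO d) :=
  ⟨fun A B => ⟨fun n => A.coeff n + B.coeff n, by
    obtain ⟨N, hN⟩ := A.bdd
    obtain ⟨M, hM⟩ := B.bdd
    refine ⟨max N M, fun n hn => ?_⟩
    rw [hN n (lt_of_le_of_lt (le_max_left _ _) hn),
      hM n (lt_of_le_of_lt (le_max_right _ _) hn), add_zero]⟩⟩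

instance : Neg (PDO d) :=
  ⟨fun A => ⟨fun n => -A.coeff n, by
    obtain ⟨N, hN⟩ := A.bdd
    exact ⟨N, fun n hn => by rw [hN n hn, neg_zero]⟩⟩⟩

@[simp] theorem coeff_zero (n : ℤ) : (0 : PDO d).coeff n = 0 := rfl
@[simp] theorem coeff_add (A B : PDO d) (n : ℤ) :
    (A + B).coeff n = A.coeff n + B.coeff n := rfl
@[simp] theorem coeff_neg (A : PDO d) (n : ℤ) : (-A).coeff n = -A.coeff n := rfl

instance : AddCommGroup (PDO d) where
  add_assoc A B C := by ext n; simp [add_assoc]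
  zero_add A := by ext n; simp
  add_zero A := by ext n; simp
  add_comm A B := by ext n; simp [add_comm]
  neg_add_cancel A := by ext n; simp
  nsmul := nsmulRec
  zsmul := zsmulRec

/-- The monomial `f Dᵖ`. -/
noncomputable def monomial (d : Derivation ℚ R R) (p : ℤ) (f : R) : PDO d :=
  ⟨fun n => if n = p then f else 0, p, fun _ hn => if_neg hn.ne'⟩

theorem coeff_monomial (p : ℤ) (f : R) (n : ℤ) :
    (monomial d p f).coeff n = if n = p then f else 0 := rfl

noncomputable instance : One (PDO d) := ⟨monomial d 0 1⟩

theorem coeff_one (n : ℤ) : (1 : PDO d).coeff n = if n = 0 then 1 else 0 :=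
  coeff_monomial 0 1 n

/-- The coefficient of `Dⁿ` in `A B`, by the generalized Leibniz rule
`Dᵖ f = ∑_{i ≥ 0} (p choose i) (dⁱ f) D^{p-i}`, `p ∈ ℤ`. -/
noncomputable def mulCoeff (d : Derivation ℚ R R) (a b : ℤ → R) (n : ℤ) : R :=
  ∑ᶠ x : ℤ × ℕ, (Ring.choose x.1 x.2 : ℤ) • (a x.1 * (⇑d)^[x.2] (b (n - x.1 + x.2)))

/-- One term of a product, indexed by the two orders that are multiplied. -/
noncomputable def mulTerm (d : Derivation ℚ R R) (p m : ℤ) (f g : R) : R :=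
  if 0 ≤ m then (Ring.choose p m.toNat : ℤ) • (f * (⇑d)^[m.toNat] g) else 0

theorem iter_sum {ι : Type*} (k : ℕ) (s : Finset ι) (f : ι → R) :
    (⇑d)^[k] (∑ i ∈ s, f i) = ∑ i ∈ s, (⇑d)^[k] (f i) := by
  induction k with
  | zero => rfl
  | succ k ih => simp only [Function.iterate_succ_apply', ih, map_sum]

theorem iter_zsmul (k : ℕ) (c : ℤ) (f : R) : (⇑d)^[k] (c • f) = c • (⇑d)^[k] f := by
  induction k with
  | zero => rfl
  | succ k ih => simp only [Function.iterate_succ_apply', ih, map_zsmul]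

theorem mulTerm_zero_left (p m : ℤ) (g : R) : mulTerm d p m 0 g = 0 := by
  simp [mulTerm]

theorem mulTerm_zero_right (p m : ℤ) (f : R) : mulTerm d p m f 0 = 0 := by
  simp [mulTerm]

theorem mulTerm_add_left (p m : ℤ) (f f' g : R) :
    mulTerm d p m (f + f') g = mulTerm d p m f g + mulTerm d p m f' g := by
  unfold mulTerm; split_ifs <;> simp [add_mul]

theorem mulTerm_add_right (p m : ℤ) (f g g' : R) :
    mulTerm d p m f (g + g') = mulTerm d p m f g + mulTerm d p m f g' := by
  unfold mulTerm; split_ifs <;> simp [mul_add]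

theorem mulTerm_sum_left {ι : Type*} (p m : ℤ) (s : Finset ι) (f : ι → R) (g : R) :
    mulTerm d p m (∑ i ∈ s, f i) g = ∑ i ∈ s, mulTerm d p m (f i) g := by
  unfold mulTerm; split_ifs <;> simp [Finset.sum_mul, Finset.smul_sum]

theorem mulTerm_sum_right {ι : Type*} (p m : ℤ) (s : Finset ι) (f : R) (g : ι → R) :
    mulTerm d p m f (∑ i ∈ s, g i) = ∑ i ∈ s, mulTerm d p m f (g i) := by
  unfold mulTerm; split_ifs <;> simp [Finset.mul_sum, Finset.smul_sum, iter_sum]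

/-- A coefficient of a product is a finite sum over any window of orders that is large enough. -/
theorem mulCoeff_window {a b : ℤ → R} {n lo hi lo' hi' : ℤ} (ha : ∀ p, hi < p → a p = 0)
    (hb : ∀ q, hi' < q → b q = 0) (hlo : lo ≤ n - hi') (hlo' : lo' ≤ n - hi) :
    mulCoeff d a b n = ∑ p ∈ Finset.Icc lo hi, ∑ q ∈ Finset.Icc lo' hi',
      mulTerm d p (p + q - n) (a p) (b q) := by
  classical
  unfold mulCoeff
  set W : Finset (ℤ × ℤ) :=
    (Finset.Icc lo hi ×ˢ Finset.Icc lo' hi').filter (fun x => 0 ≤ x.1 + x.2 - n) with hW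
  have hinj : Set.InjOn (fun x : ℤ × ℤ => ((x.1, (x.1 + x.2 - n).toNat) : ℤ × ℕ)) W := by
    rintro ⟨p, q⟩ h ⟨p', q'⟩ h' e
    simp only [hW, Finset.coe_filter, Set.mem_ofPred_eq] at h h'
    simp only [Prod.mk.injEq] at e ⊢
    refine ⟨e.1, ?_⟩
    have h1 := h.2; have h2 := h'.2; have h3 := e.1; have h4 := e.2
    omega
  rw [finsum_eq_sum_of_support_subset (s := W.image
    (fun x : ℤ × ℤ => ((x.1, (x.1 + x.2 - n).toNat) : ℤ × ℕ)))]
  · rw [Finset.sum_image hinj, hW, Finset.sum_filter, Finset.sum_product]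
    refine Finset.sum_congr rfl fun p _ => Finset.sum_congr rfl fun q _ => ?_
    simp only [mulTerm]
    split_ifs with h
    · have : n - p + ((p + q - n).toNat : ℤ) = q := by omega
      rw [this]
    · rfl
  · rintro ⟨p, i⟩ hx
    rw [Function.mem_support] at hx
    have hp : p ≤ hi := by
      by_contra hc
      exact hx (by simp [ha p (not_le.mp hc)])
    have hq : n - p + i ≤ hi' := by
      by_contra hc
      exact hx (by simp [hb _ (not_le.mp hc)])
    rw [Finset.coe_image]
    refine ⟨(p, n - p + i), ?_, ?_⟩
    · simp only [hW, Finset.coe_filter, Set.mem_ofPred_eq, Finset.mem_product, Finset.mem_Icc]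
      omega
    · simp only [Prod.mk.injEq, true_and]
      omega

noncomputable instance : Mul (PDO d) :=
  ⟨fun A B => ⟨mulCoeff d A.coeff B.coeff, by
    obtain ⟨N, hN⟩ := A.bdd
    obtain ⟨M, hM⟩ := B.bdd
    refine ⟨N + M, fun n hn => finsum_eq_zero_of_forall_eq_zero fun x => ?_⟩
    by_cases h : N < x.1
    · rw [hN _ h, zero_mul, smul_zero]
    · rw [hM _ (by omega), iterate_map_zero, mul_zero, smul_zero]⟩⟩

theorem coeff_mul (A B : PDO d) (n : ℤ) :
    (A * B).coeff n = mulCoeff d A.coeff B.coeff n := rfl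

theorem exists_hi (A B C : PDO d) : ∃ hi : ℤ, 0 ≤ hi ∧ (∀ p, hi < p → A.coeff p = 0) ∧
    (∀ p, hi < p → B.coeff p = 0) ∧ (∀ p, hi < p → C.coeff p = 0) := by
  obtain ⟨N, hN⟩ := A.bdd
  obtain ⟨M, hM⟩ := B.bdd
  obtain ⟨K, hK⟩ := C.bdd
  refine ⟨max 0 (max N (max M K)), by simp, fun p hp => hN p ?_, fun p hp => hM p ?_,
    fun p hp => hK p ?_⟩ <;> simp only [max_lt_iff] at hp <;> omega

theorem leibniz_iter (k : ℕ) (f g : R) : (⇑d)^[k] (f * g) =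
    ∑ x ∈ Finset.HasAntidiagonal.antidiagonal k,
      k.choose x.1 • ((⇑d)^[x.1] f * (⇑d)^[x.2] g) := by
  induction k with
  | zero => simp
  | succ k ih =>
    rw [Finset.sum_antidiagonal_choose_succ_nsmul
      (fun i j => (⇑d)^[i] f * (⇑d)^[j] g) k, Function.iterate_succ_apply', ih, map_sum,
      ← Finset.sum_add_distrib]
    refine Finset.sum_congr rfl fun x hx => ?_
    have hx' : x.1 + x.2 = k := Finset.HasAntidiagonal.mem_antidiagonal.mp hx
    have hc : k.choose x.2 = k.choose x.1 := by
      rw [← hx', Nat.choose_symm_add]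
    rw [hc, map_nsmul, d.leibniz, ← smul_add, Function.iterate_succ_apply',
      Function.iterate_succ_apply', smul_eq_mul, smul_eq_mul, mul_comm (d _)]

theorem sum_triple {M : Type*} [AddCommMonoid M] (m : ℕ) (F : ℕ → ℕ → ℕ → M) :
    ∑ x ∈ Finset.HasAntidiagonal.antidiagonal m,
      ∑ y ∈ Finset.HasAntidiagonal.antidiagonal x.1, F y.1 y.2 x.2 =
    ∑ x ∈ Finset.HasAntidiagonal.antidiagonal m,
      ∑ y ∈ Finset.HasAntidiagonal.antidiagonal x.2, F x.1 y.1 y.2 := by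
  rw [Finset.sum_sigma', Finset.sum_sigma']
  refine Finset.sum_nbij' (fun z => ⟨(z.2.1, z.2.2 + z.1.2), (z.2.2, z.1.2)⟩)
    (fun z => ⟨(z.1.1 + z.2.1, z.2.2), (z.1.1, z.2.1)⟩) ?_ ?_ ?_ ?_ ?_
  · rintro ⟨⟨a, b⟩, ⟨c, e⟩⟩ h
    obtain ⟨h1, h2⟩ := Finset.mem_sigma.mp h
    have h1' : a + b = m := Finset.HasAntidiagonal.mem_antidiagonal.mp h1
    have h2' : c + e = a := Finset.HasAntidiagonal.mem_antidiagonal.mp h2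
    refine Finset.mem_sigma.mpr ⟨Finset.HasAntidiagonal.mem_antidiagonal.mpr ?_,
      Finset.HasAntidiagonal.mem_antidiagonal.mpr ?_⟩ <;> dsimp only <;> omega
  · rintro ⟨⟨a, b⟩, ⟨c, e⟩⟩ h
    obtain ⟨h1, h2⟩ := Finset.mem_sigma.mp h
    have h1' : a + b = m := Finset.HasAntidiagonal.mem_antidiagonal.mp h1
    have h2' : c + e = b := Finset.HasAntidiagonal.mem_antidiagonal.mp h2
    refine Finset.mem_sigma.mpr ⟨Finset.HasAntidiagonal.mem_antidiagonal.mpr ?_,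
      Finset.HasAntidiagonal.mem_antidiagonal.mpr ?_⟩ <;> dsimp only <;> omega
  · rintro ⟨⟨a, b⟩, ⟨c, e⟩⟩ h
    simp only [Finset.mem_sigma, Finset.HasAntidiagonal.mem_antidiagonal] at h
    obtain ⟨h1, h2⟩ := h
    subst h2
    rfl
  · rintro ⟨⟨a, b⟩, ⟨c, e⟩⟩ h
    simp only [Finset.mem_sigma, Finset.HasAntidiagonal.mem_antidiagonal] at h
    obtain ⟨h1, h2⟩ := h
    subst h2
    rfl
  · intros; rfl

theorem assoc_core (p q : ℤ) (m : ℕ) (f g h : R) :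
    ∑ x ∈ Finset.HasAntidiagonal.antidiagonal m, (Ring.choose (p + q - x.1) x.2 : ℤ) •
      (((Ring.choose p x.1 : ℤ) • (f * (⇑d)^[x.1] g)) * (⇑d)^[x.2] h) =
    ∑ x ∈ Finset.HasAntidiagonal.antidiagonal m, (Ring.choose p x.1 : ℤ) •
      (f * (⇑d)^[x.1] ((Ring.choose q x.2 : ℤ) • (g * (⇑d)^[x.2] h))) := by
  have key := sum_triple m (fun i e k =>
    (Ring.choose p i * Ring.choose (p - i) e * Ring.choose q k : ℤ) •
      (f * ((⇑d)^[i] g * (⇑d)^[e + k] h)))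
  refine Eq.trans ?_ (key.symm.trans ?_)
  · refine Finset.sum_congr rfl fun x _ => ?_
    have hv := Ring.add_choose_eq (r := p - x.1) (s := q) x.2 (Commute.all _ _)
    rw [show p + q - x.1 = p - x.1 + q by ring, hv, Finset.sum_smul]
    refine Finset.sum_congr rfl fun y hy => ?_
    rw [Finset.HasAntidiagonal.mem_antidiagonal.mp hy, smul_mul_assoc, smul_smul]
    congr 1 <;> ring
  · refine Finset.sum_congr rfl fun x _ => ?_
    rw [iterate_map_zsmul, leibniz_iter, mul_smul_comm, smul_smul, Finset.mul_sum,
      Finset.smul_sum]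
    refine Finset.sum_congr rfl fun y hy => ?_
    have hy' : y.1 + y.2 = x.1 := Finset.HasAntidiagonal.mem_antidiagonal.mp hy
    have hc := Ring.choose_smul_choose p (n := x.1) (k := y.1) (by omega)
    rw [show x.1 - y.1 = y.2 by omega] at hc
    rw [← hc, ← Function.iterate_add_apply, mul_smul_comm, ← natCast_zsmul, ← natCast_zsmul, smul_smul]
    congr 1
    rw [smul_eq_mul]
    ring

theorem mul_assoc_left (p q r n L H : ℤ) (f g h : R) (hL : L ≤ n - r) (hH : p + q ≤ H) :
    ∑ s ∈ Finset.Icc L H, mulTerm d s (s + r - n) (mulTerm d p (p + q - s) f g) h =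
    if 0 ≤ p + q + r - n then
      ∑ x ∈ Finset.HasAntidiagonal.antidiagonal (p + q + r - n).toNat,
        (Ring.choose (p + q - x.1) x.2 : ℤ) •
          (((Ring.choose p x.1 : ℤ) • (f * (⇑d)^[x.1] g)) * (⇑d)^[x.2] h)
    else 0 := by
  have hsub : Finset.Icc (n - r) (p + q) ⊆ Finset.Icc L H := Finset.Icc_subset_Icc hL hH
  rw [← Finset.sum_subset hsub]
  · split_ifs with hm
    · symm
      refine Finset.sum_nbij' (fun x => p + q - x.1)
        (fun s => ((p + q - s).toNat, (s + r - n).toNat)) ?_ ?_ ?_ ?_ ?_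
      · intro x hx
        rw [Finset.HasAntidiagonal.mem_antidiagonal] at hx
        rw [Finset.mem_Icc]; omega
      · intro s hs
        rw [Finset.mem_Icc] at hs
        rw [Finset.HasAntidiagonal.mem_antidiagonal]; omega
      · rintro ⟨i, j⟩ hx
        rw [Finset.HasAntidiagonal.mem_antidiagonal] at hx
        simp only [Prod.mk.injEq] at hx ⊢; omega
      · intro s hs
        rw [Finset.mem_Icc] at hs
        simp only; omega
      · rintro ⟨i, j⟩ hx
        rw [Finset.HasAntidiagonal.mem_antidiagonal] at hx
        simp only at hx ⊢
        rw [mulTerm, mulTerm, if_pos (by omega), if_pos (by omega),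
          show (p + q - (p + q - (i : ℤ))).toNat = i by omega,
          show (p + q - (i : ℤ) + r - n).toNat = j by omega]
    · rw [Finset.Icc_eq_empty (by omega), Finset.sum_empty]
  · intro s _ hs
    rw [Finset.mem_Icc, not_and_or] at hs
    rcases hs with hs | hs
    · rw [mulTerm, if_neg (by omega)]
    · have hz : mulTerm d p (p + q - s) f g = 0 := if_neg (by omega)
      rw [hz, mulTerm_zero_left]

theorem mul_assoc_right (p q r n L H : ℤ) (f g h : R) (hL : L ≤ n - p) (hH : q + r ≤ H) :
    ∑ s ∈ Finset.Icc L H, mulTerm d p (p + s - n) f (mulTerm d q (q + r - s) g h) =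
    if 0 ≤ p + q + r - n then
      ∑ x ∈ Finset.HasAntidiagonal.antidiagonal (p + q + r - n).toNat,
        (Ring.choose p x.1 : ℤ) •
          (f * (⇑d)^[x.1] ((Ring.choose q x.2 : ℤ) • (g * (⇑d)^[x.2] h)))
    else 0 := by
  have hsub : Finset.Icc (n - p) (q + r) ⊆ Finset.Icc L H := Finset.Icc_subset_Icc hL hH
  rw [← Finset.sum_subset hsub]
  · split_ifs with hm
    · symm
      refine Finset.sum_nbij' (fun x => n - p + x.1)
        (fun s => ((p + s - n).toNat, (q + r - s).toNat)) ?_ ?_ ?_ ?_ ?_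
      · intro x hx
        rw [Finset.HasAntidiagonal.mem_antidiagonal] at hx
        rw [Finset.mem_Icc]; omega
      · intro s hs
        rw [Finset.mem_Icc] at hs
        rw [Finset.HasAntidiagonal.mem_antidiagonal]; omega
      · rintro ⟨i, j⟩ hx
        rw [Finset.HasAntidiagonal.mem_antidiagonal] at hx
        simp only [Prod.mk.injEq] at hx ⊢; omega
      · intro s hs
        rw [Finset.mem_Icc] at hs
        simp only; omega
      · rintro ⟨i, j⟩ hx
        rw [Finset.HasAntidiagonal.mem_antidiagonal] at hx
        simp only at hx ⊢
        rw [mulTerm, mulTerm, if_pos (by omega), if_pos (by omega),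
          show (p + (n - p + (i : ℤ)) - n).toNat = i by omega,
          show (q + r - (n - p + (i : ℤ))).toNat = j by omega]
    · rw [Finset.Icc_eq_empty (by omega), Finset.sum_empty]
  · intro s _ hs
    rw [Finset.mem_Icc, not_and_or] at hs
    rcases hs with hs | hs
    · rw [mulTerm, if_neg (by omega)]
    · have hz : mulTerm d q (q + r - s) g h = 0 := if_neg (by omega)
      rw [hz, mulTerm_zero_right]

theorem coeff_mul_eq_zero {A B : PDO d} {hi n : ℤ} (hA : ∀ p, hi < p → A.coeff p = 0)
    (hB : ∀ p, hi < p → B.coeff p = 0) (hn : 2 * hi < n) : (A * B).coeff n = 0 := by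
  refine finsum_eq_zero_of_forall_eq_zero fun x => ?_
  by_cases h : hi < x.1
  · rw [hA _ h, zero_mul, smul_zero]
  · rw [hB _ (by omega), iterate_map_zero, mul_zero, smul_zero]

protected theorem mul_assoc (A B C : PDO d) : A * B * C = A * (B * C) := by
  obtain ⟨h, h0, hA, hB, hC⟩ := exists_hi A B C
  ext n
  rw [coeff_mul (A * B) C, coeff_mul A (B * C),
    mulCoeff_window (lo := n - 2 * h) (hi := 2 * h) (lo' := n - 3 * h) (hi' := h)
      (fun p hp => coeff_mul_eq_zero hA hB hp) hC (by omega) (by omega),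
    mulCoeff_window (lo := n - 3 * h) (hi := h) (lo' := n - 2 * h) (hi' := 2 * h)
      hA (fun p hp => coeff_mul_eq_zero hB hC hp) (by omega) (by omega)]
  have e1 : ∀ s ∈ Finset.Icc (n - 2 * h) (2 * h), ∀ r ∈ Finset.Icc (n - 3 * h) h,
      mulTerm d s (s + r - n) ((A * B).coeff s) (C.coeff r) =
      ∑ p ∈ Finset.Icc (n - 3 * h) h, ∑ q ∈ Finset.Icc (n - 3 * h) h,
        mulTerm d s (s + r - n) (mulTerm d p (p + q - s) (A.coeff p) (B.coeff q))
          (C.coeff r) := by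
    intro s hs r _
    rw [Finset.mem_Icc] at hs
    rw [coeff_mul, mulCoeff_window (lo := n - 3 * h) (hi := h) (lo' := n - 3 * h) (hi' := h)
      hA hB (by omega) (by omega), mulTerm_sum_left]
    exact Finset.sum_congr rfl fun p _ => mulTerm_sum_left _ _ _ _ _
  have e2 : ∀ p ∈ Finset.Icc (n - 3 * h) h, ∀ s ∈ Finset.Icc (n - 2 * h) (2 * h),
      mulTerm d p (p + s - n) (A.coeff p) ((B * C).coeff s) =
      ∑ q ∈ Finset.Icc (n - 3 * h) h, ∑ r ∈ Finset.Icc (n - 3 * h) h,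
        mulTerm d p (p + s - n) (A.coeff p)
          (mulTerm d q (q + r - s) (B.coeff q) (C.coeff r)) := by
    intro p _ s hs
    rw [Finset.mem_Icc] at hs
    rw [coeff_mul, mulCoeff_window (lo := n - 3 * h) (hi := h) (lo' := n - 3 * h) (hi' := h)
      hB hC (by omega) (by omega), mulTerm_sum_right]
    exact Finset.sum_congr rfl fun q _ => mulTerm_sum_right _ _ _ _ _
  rw [Finset.sum_congr rfl fun s hs => Finset.sum_congr rfl fun r hr => e1 s hs r hr,
    Finset.sum_congr rfl fun p hp => Finset.sum_congr rfl fun s hs => e2 p hp s hs]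
  have c1 : ∀ F : ℤ → ℤ → ℤ → ℤ → R,
      ∑ s ∈ Finset.Icc (n - 2 * h) (2 * h), ∑ r ∈ Finset.Icc (n - 3 * h) h,
        ∑ p ∈ Finset.Icc (n - 3 * h) h, ∑ q ∈ Finset.Icc (n - 3 * h) h, F s r p q =
      ∑ p ∈ Finset.Icc (n - 3 * h) h, ∑ q ∈ Finset.Icc (n - 3 * h) h,
        ∑ r ∈ Finset.Icc (n - 3 * h) h, ∑ s ∈ Finset.Icc (n - 2 * h) (2 * h), F s r p q := by
    intro F
    rw [Finset.sum_comm]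
    simp_rw [Finset.sum_comm (s := Finset.Icc (n - 2 * h) (2 * h))]
    rw [Finset.sum_comm]
    refine Finset.sum_congr rfl fun p _ => ?_
    rw [Finset.sum_comm]
  have c2 : ∀ F : ℤ → ℤ → ℤ → ℤ → R,
      ∑ p ∈ Finset.Icc (n - 3 * h) h, ∑ s ∈ Finset.Icc (n - 2 * h) (2 * h),
        ∑ q ∈ Finset.Icc (n - 3 * h) h, ∑ r ∈ Finset.Icc (n - 3 * h) h, F p s q r =
      ∑ p ∈ Finset.Icc (n - 3 * h) h, ∑ q ∈ Finset.Icc (n - 3 * h) h,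
        ∑ r ∈ Finset.Icc (n - 3 * h) h, ∑ s ∈ Finset.Icc (n - 2 * h) (2 * h), F p s q r := by
    intro F
    simp_rw [Finset.sum_comm (s := Finset.Icc (n - 2 * h) (2 * h))]
  rw [c1, c2]
  refine Finset.sum_congr rfl fun p hp => Finset.sum_congr rfl fun q hq =>
    Finset.sum_congr rfl fun r hr => ?_
  rw [Finset.mem_Icc] at hp hq hr
  rw [mul_assoc_left p q r n _ _ _ _ _ (by omega) (by omega),
    mul_assoc_right p q r n _ _ _ _ _ (by omega) (by omega)]
  split_ifs with hm
  · exact assoc_core p q _ _ _ _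
  · rfl

theorem coeff_zero_monomial_mul (f : R) (B : PDO d) (n : ℤ) :
    (monomial d 0 f * B).coeff n = f * B.coeff n := by
  rw [coeff_mul, mulCoeff, finsum_eq_single _ ((0, 0) : ℤ × ℕ)]
  · simp [coeff_monomial]
  · rintro ⟨p, i⟩ h
    by_cases hp : p = 0
    · subst hp
      have hi : i ≠ 0 := fun h' => h (by rw [h'])
      have : Ring.choose (0 : ℤ) i = 0 := by rw [Ring.choose_zero_ite, if_neg hi]
      simp [this]
    · simp [coeff_monomial, hp]

theorem coeff_mul_monomial_one (A : PDO d) (q n : ℤ) :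
    (A * monomial d q 1).coeff n = A.coeff (n - q) := by
  have h1 : ∀ i : ℕ, i ≠ 0 → (⇑d)^[i] (1 : R) = 0 := by
    intro i hi
    obtain ⟨j, rfl⟩ := Nat.exists_eq_succ_of_ne_zero hi
    rw [Function.iterate_succ_apply, d.map_one_eq_zero, iterate_map_zero]
  rw [coeff_mul, mulCoeff, finsum_eq_single _ ((n - q, 0) : ℤ × ℕ)]
  · simp [coeff_monomial]
  · rintro ⟨p, i⟩ h
    by_cases hi : i = 0
    · subst hi
      have hp : n - p ≠ q := fun h' => h (by rw [← h']; simp)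
      simp [coeff_monomial, hp]
    · simp only [coeff_monomial]
      split_ifs
      · simp [h1 i hi]
      · simp

protected theorem mul_add (A B C : PDO d) : A * (B + C) = A * B + A * C := by
  obtain ⟨h, -, hA, hB, hC⟩ := exists_hi A B C
  have hBC : ∀ p, h < p → (B + C).coeff p = 0 := fun p hp => by
    rw [coeff_add, hB p hp, hC p hp, add_zero]
  ext n
  rw [coeff_add, coeff_mul, coeff_mul, coeff_mul, mulCoeff_window hA hBC le_rfl le_rfl,
    mulCoeff_window hA hB le_rfl le_rfl, mulCoeff_window hA hC le_rfl le_rfl]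
  simp only [coeff_add, mulTerm_add_right, Finset.sum_add_distrib]

protected theorem add_mul (A B C : PDO d) : (A + B) * C = A * C + B * C := by
  obtain ⟨h, -, hA, hB, hC⟩ := exists_hi A B C
  have hAB : ∀ p, h < p → (A + B).coeff p = 0 := fun p hp => by
    rw [coeff_add, hA p hp, hB p hp, add_zero]
  ext n
  rw [coeff_add, coeff_mul, coeff_mul, coeff_mul, mulCoeff_window hAB hC le_rfl le_rfl,
    mulCoeff_window hA hC le_rfl le_rfl, mulCoeff_window hB hC le_rfl le_rfl]
  simp only [coeff_add, mulTerm_add_left, Finset.sum_add_distrib]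

noncomputable instance : Ring (PDO d) where
  mul_assoc := PDO.mul_assoc
  left_distrib := PDO.mul_add
  right_distrib := PDO.add_mul
  one_mul A := by
    ext n
    exact (coeff_zero_monomial_mul 1 A n).trans (one_mul _)
  mul_one A := by
    ext n
    exact (coeff_mul_monomial_one A 0 n).trans (by rw [sub_zero])
  zero_mul A := by
    ext n
    exact finsum_eq_zero_of_forall_eq_zero fun x => by simp
  mul_zero A := by
    ext n
    exact finsum_eq_zero_of_forall_eq_zero fun x => by simp
  neg_add_cancel := neg_add_cancel
  zsmul := zsmulRec

theorem monomial_one_mul_monomial_one (p q : ℤ) :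
    monomial d p 1 * monomial d q 1 = monomial d (p + q) 1 := by
  ext n
  rw [coeff_mul_monomial_one, coeff_monomial, coeff_monomial]
  congr 1
  exact propext sub_eq_iff_eq_add

/-- The operator `D⁻¹`. -/
noncomputable def Dinv (d : Derivation ℚ R R) : PDO d := monomial d (-1) 1

/-- The invertible operator `D`, with inverse `D⁻¹`. -/
noncomputable def D (d : Derivation ℚ R R) : (PDO d)ˣ where
  val := monomial d 1 1
  inv := Dinv d
  val_inv := monomial_one_mul_monomial_one 1 (-1)
  inv_val := monomial_one_mul_monomial_one (-1) 1

/-- The operator of multiplication by the function `f`. -/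
noncomputable def mulOp (d : Derivation ℚ R R) (f : R) : PDO d := monomial d 0 f

/-- The purely differential part `A₊ = ∑_{n ≥ 0} aₙ Dⁿ`. -/
def plus (A : PDO d) : PDO d :=
  ⟨fun n => if 0 ≤ n then A.coeff n else 0, by
    obtain ⟨N, hN⟩ := A.bdd
    exact ⟨N, fun n hn => by rw [hN n hn, ite_self]⟩⟩

/-- The purely pseudo-differential part `A₋ = ∑_{n < 0} aₙ Dⁿ`. -/
def minus (A : PDO d) : PDO d :=
  ⟨fun n => if n < 0 then A.coeff n else 0, by
    obtain ⟨N, hN⟩ := A.bdd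
    exact ⟨N, fun n hn => by rw [hN n hn, ite_self]⟩⟩

/-- The residue `Res A`, the coefficient of `D⁻¹`. -/
def res (A : PDO d) : R := A.coeff (-1)

/-- The action `A₊(f) = ∑_{n ≥ 0} aₙ dⁿ f` of the differential part of `A` on a function. -/
noncomputable def plusApply (A : PDO d) (f : R) : R :=
  ∑ᶠ n : ℕ, A.coeff n * (⇑d)^[n] f

/-- The action `(A₊)*(f) = ∑_{n ≥ 0} (-1)ⁿ dⁿ (aₙ f)` of the formal adjoint of the differential
part of `A` on a function; note that `(A₊)* = (A*)₊`. -/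
noncomputable def adjPlusApply (A : PDO d) (f : R) : R :=
  ∑ᶠ n : ℕ, (-1) ^ n * (⇑d)^[n] (A.coeff n * f)

end PDO

namespace KP

variable {R : Type*} [CommRing R] [Algebra ℚ R]

/-- The operator `p_n(-[∂])` with `[∂] = (∂₁, ∂₂/2, ∂₃/3, …)`, where the Schur polynomials are
given by `∑ₙ λⁿ p_n(t₁, t₂, …) = exp (∑_{l ≥ 1} λˡ t_l)`: it is the coefficient of `λⁿ` in
`exp (-∑_{l ≥ 1} λˡ ∂_l / l)`, in whose expansion only the powers up to the `n`-th contribute. -/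
noncomputable def schurNeg (δ : ℕ+ → Derivation ℚ R R) (n : ℕ) : Module.End ℚ R :=
  ∑ k ∈ Finset.range (n + 1), (k.factorial : ℚ)⁻¹ • PowerSeries.coeff n
    ((PowerSeries.mk fun l : ℕ => if h : 0 < l then
      -((l : ℚ)⁻¹ • ((δ ⟨l, h⟩ : Derivation ℚ R R) : R →ₗ[ℚ] R)) else (0 : Module.End ℚ R)) ^ k)

/-- The dressing operator `∑ₙ (p_n(-[∂]) τ / τ) D⁻ⁿ` of a tau-function. -/
noncomputable def dressing (δ : ℕ+ → Derivation ℚ R R) (τ : R) : PDO (δ 1) :=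
  ⟨fun z => if z ≤ 0 then schurNeg δ (-z).toNat τ * τ⁻¹ʳ else 0, 0,
    fun _ hz => if_neg (not_le.mpr hz)⟩

/-- For a dressing operator `W`, the fractional power `L^{n/r} = W Dⁿ W⁻¹` of the Lax operator
`L = W Dʳ W⁻¹`. -/
noncomputable def laxPow (δ : ℕ+ → Derivation ℚ R R) (W : (PDO (δ 1))ˣ) (n : ℕ+) : PDO (δ 1) :=
  ((W * PDO.D (δ 1) ^ (n : ℕ) * W⁻¹ : (PDO (δ 1))ˣ) : PDO (δ 1))

/-- `Φ` is an eigenfunction: `∂_n Φ = (L^{n/r})₊(Φ)` for all `n`. -/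
def IsEigenfunction (δ : ℕ+ → Derivation ℚ R R) (W : (PDO (δ 1))ˣ) (Φ : R) : Prop :=
  ∀ n : ℕ+, δ n Φ = PDO.plusApply (laxPow δ W n) Φ

/-- `Ψ` is an adjoint eigenfunction: `∂_n Ψ = -((L*)^{n/r})₊(Ψ)` for all `n`. -/
def IsAdjEigenfunction (δ : ℕ+ → Derivation ℚ R R) (W : (PDO (δ 1))ˣ) (Ψ : R) : Prop :=
  ∀ n : ℕ+, δ n Ψ = -PDO.adjPlusApply (laxPow δ W n) Ψ

/-- `S` is a squared eigenfunction potential of `Φ`, `Ψ`: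
`∂_n S = Res (D⁻¹ Ψ (L^{n/r})₊ Φ D⁻¹)` for all `n`. -/
def IsSEP (δ : ℕ+ → Derivation ℚ R R) (W : (PDO (δ 1))ˣ) (Φ Ψ S : R) : Prop :=
  ∀ n : ℕ+, δ n S = PDO.res (PDO.Dinv (δ 1) * PDO.mulOp (δ 1) Ψ *
    PDO.plus (laxPow δ W n) * PDO.mulOp (δ 1) Φ * PDO.Dinv (δ 1))

/-- The objects at one site of the lattice: dressing operator, the functions `Φ_i`, `Ψ_i`
of the Lax operator, and the tau-function. -/
structure Site (δ : ℕ+ → Derivation ℚ R R) (m : ℕ) where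
  W : (PDO (δ 1))ˣ
  Φ : Fin m → R
  Ψ : Fin m → R
  τ : R

/-- The Lax operator `L = W Dʳ W⁻¹` at a site. -/
noncomputable def Site.lax {δ : ℕ+ → Derivation ℚ R R} {m : ℕ} (X : Site δ m) (r : ℕ+) :
    PDO (δ 1) := laxPow δ X.W r

/-- `X` is a solution of the constrained KP hierarchy `cKP_{r,m}` with tau-function `X.τ`. -/
structure IsCKP {δ : ℕ+ → Derivation ℚ R R} {m : ℕ} (r : ℕ+) (X : Site δ m) : Prop where
  isUnit_tau : IsUnit X.τ
  dressing_eq : (X.W : PDO (δ 1)) = dressing δ X.τ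
  /-- The Wilson-Sato equations `∂_n W = -(L^{n/r})₋ W`. -/
  wilson_sato : ∀ (n : ℕ+) (z : ℤ), δ n ((X.W : PDO (δ 1)).coeff z) =
    (-(PDO.minus (laxPow δ X.W n) * (X.W : PDO (δ 1)))).coeff z
  /-- The constraint `L₋ = ∑_i Φ_i D⁻¹ Ψ_i`. -/
  lax_minus : PDO.minus (X.lax r) = ∑ i, PDO.mulOp (δ 1) (X.Φ i) *
    PDO.Dinv (δ 1) * PDO.mulOp (δ 1) (X.Ψ i)
  eigen : ∀ i, IsEigenfunction δ X.W (X.Φ i)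
  adj_eigen : ∀ i, IsAdjEigenfunction δ X.W (X.Ψ i)

/-- `Y` is the Darboux-Bäcklund transform of `X` with respect to the eigenfunction `Φ_a`,
`T_a = Φ_a D Φ_a⁻¹`, where `S i` is the squared eigenfunction potential `S(Φ_a, Ψ_i)`. The rule
`ψ_BA ↦ λ⁻¹ T_a(ψ_BA)` for the Baker-Akhiezer function reads `W ↦ T_a W D⁻¹` for the dressing
operator, so that `L ↦ T_a L T_a⁻¹`. Here
`L(Φ_a) = L₊(Φ_a) + ∑_i Φ_i S(Φ_a, Ψ_i)` and `T_a(f) = Φ_a ∂ₓ(f / Φ_a)`. -/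
structure IsDB {δ : ℕ+ → Derivation ℚ R R} {m : ℕ} (r : ℕ+) (a : Fin m) (S : Fin m → R)
    (X Y : Site δ m) : Prop where
  isUnit : IsUnit (X.Φ a)
  sep : ∀ i, IsSEP δ X.W (X.Φ a) (X.Ψ i) (S i)
  dressing_eq : (Y.W : PDO (δ 1)) = PDO.mulOp (δ 1) (X.Φ a) * (PDO.D (δ 1) : PDO (δ 1)) *
    PDO.mulOp (δ 1) (X.Φ a)⁻¹ʳ * (X.W : PDO (δ 1)) * PDO.Dinv (δ 1)
  phi_self : Y.Φ a = X.Φ a *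
    δ 1 ((PDO.plusApply (X.lax r) (X.Φ a) + ∑ i, X.Φ i * S i) * (X.Φ a)⁻¹ʳ)
  psi_self : Y.Ψ a = (X.Φ a)⁻¹ʳ
  phi_other : ∀ i, i ≠ a → Y.Φ i = X.Φ a * δ 1 (X.Φ i * (X.Φ a)⁻¹ʳ)
  psi_other : ∀ i, i ≠ a → Y.Ψ i = -((X.Φ a)⁻¹ʳ * S i)
  tau_eq : Y.τ = X.Φ a * X.τ

/-- `Y` is the adjoint Darboux-Bäcklund transform of `X` with respect to the adjoint
eigenfunction `Ψ_b`, `T_b = Ψ_b D Ψ_b⁻¹`, where `S i` is the squared eigenfunction potential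
`S(Φ_i, Ψ_b)`. As `T_b* = -Ψ_b⁻¹ D Ψ_b`, the rule `ψ_BA ↦ -λ T_b*⁻¹(ψ_BA)` reads
`W ↦ Ψ_b⁻¹ D⁻¹ Ψ_b W D`, so that `L ↦ T_b*⁻¹ L T_b*`. Here
`L*(Ψ_b) = (L₊)*(Ψ_b) - ∑_i Ψ_i S(Φ_i, Ψ_b)`, as `(Φ_i D⁻¹ Ψ_i)* = -Ψ_i D⁻¹ Φ_i`. -/
structure IsAdjDB {δ : ℕ+ → Derivation ℚ R R} {m : ℕ} (r : ℕ+) (b : Fin m) (S : Fin m → R)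
    (X Y : Site δ m) : Prop where
  isUnit : IsUnit (X.Ψ b)
  sep : ∀ i, IsSEP δ X.W (X.Φ i) (X.Ψ b) (S i)
  dressing_eq : (Y.W : PDO (δ 1)) = PDO.mulOp (δ 1) (X.Ψ b)⁻¹ʳ *
    PDO.Dinv (δ 1) * PDO.mulOp (δ 1) (X.Ψ b) * (X.W : PDO (δ 1)) *
    (PDO.D (δ 1) : PDO (δ 1))
  phi_self : Y.Φ b = -(X.Ψ b)⁻¹ʳ
  psi_self : Y.Ψ b = X.Ψ b *
    δ 1 ((PDO.adjPlusApply (X.lax r) (X.Ψ b) - ∑ i, X.Ψ i * S i) * (X.Ψ b)⁻¹ʳ)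
  phi_other : ∀ i, i ≠ b → Y.Φ i = -((X.Ψ b)⁻¹ʳ * S i)
  psi_other : ∀ i, i ≠ b → Y.Ψ i = X.Ψ b * δ 1 (X.Ψ i * (X.Ψ b)⁻¹ʳ)
  tau_eq : Y.τ = X.Ψ b * X.τ

/-- The sites `(n, k) ∈ Ω` form a binary Darboux-Bäcklund orbit on `cKP_{r,m}` with respect to
the fixed indices `a` and `b`: site `(0, 0)` is a solution of `cKP_{r,m}`, a step `n → n + 1` is a
Darboux-Bäcklund transformation and a step `k → k + 1` an adjoint one. `S n k i j` is the squared
eigenfunction potential of `Φ_i` and `Ψ_j` at the site `(n, k)`. The set `Ω` is meant to be closed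
downwards; it is all of `ℕ × ℕ` if the orbit does not terminate. -/
structure IsBinaryDBOrbit {δ : ℕ+ → Derivation ℚ R R} {m : ℕ} (r : ℕ+) (a b : Fin m)
    (Ω : Set (ℕ × ℕ)) (X : ℕ → ℕ → Site δ m) (S : ℕ → ℕ → Fin m → Fin m → R) : Prop where
  initial : IsCKP r (X 0 0)
  step : ∀ n k, (n + 1, k) ∈ Ω → IsDB r a (fun j => S n k a j) (X n k) (X (n + 1) k)
  adj_step : ∀ n k, (n, k + 1) ∈ Ω → IsAdjDB r b (fun i => S n k i b) (X n k) (X n (k + 1))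

/-- `∂ₓ ∂_{t_r} ln f`, for invertible `f`, where `∂_{t_r} ln f = (∂_{t_r} f) / f`. -/
noncomputable def ddlog (δ : ℕ+ → Derivation ℚ R R) (r : ℕ+) (f : R) : R :=
  δ 1 (δ r f * f⁻¹ʳ)

/-- The Toda square-lattice equation at the site `(n, k)`, `n, k ≥ 1`, for tau-functions. -/
def TodaTau (δ : ℕ+ → Derivation ℚ R R) (r : ℕ+) (τ : ℕ → ℕ → R) (n k : ℕ) : Prop :=
  ddlog δ r (τ n k) =
    (τ (n + 1) k * τ (n - 1) k - τ n (k + 1) * τ n (k - 1)) * ((τ n k) ^ 2)⁻¹ʳ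

/-- The same equation in bilinear form. -/
def TodaBilinear (δ : ℕ+ → Derivation ℚ R R) (r : ℕ+) (τ : ℕ → ℕ → R) (n k : ℕ) : Prop :=
  τ n k * δ 1 (δ r (τ n k)) - δ 1 (τ n k) * δ r (τ n k) =
    τ (n + 1) k * τ (n - 1) k - τ n (k + 1) * τ n (k - 1)

/-- The equation of motion of the lattice field `Φ` in the coupled system. -/
def TodaPhi (δ : ℕ+ → Derivation ℚ R R) (r : ℕ+) (Φ Ψ : ℕ → ℕ → R) (n k : ℕ) : Prop :=
  ddlog δ r (Φ n k) =
    (Φ (n + 1) k * (Φ n k)⁻¹ʳ - Φ n k * (Φ (n - 1) k)⁻¹ʳ) -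
    (Ψ (n + 1) k * (Ψ (n + 1) (k - 1))⁻¹ʳ - Ψ n k * (Ψ n (k - 1))⁻¹ʳ)

/-- The equation of motion of the lattice field `Ψ` in the coupled system. -/
def TodaPsi (δ : ℕ+ → Derivation ℚ R R) (r : ℕ+) (Φ Ψ : ℕ → ℕ → R) (n k : ℕ) : Prop :=
  ddlog δ r (Ψ n k) =
    -(Ψ n (k + 1) * (Ψ n k)⁻¹ʳ - Ψ n k * (Ψ n (k - 1))⁻¹ʳ) +
    (Φ n (k + 1) * (Φ (n - 1) (k + 1))⁻¹ʳ - Φ n k * (Φ (n - 1) k)⁻¹ʳ)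

end KP

/-! Everything rests on one fact: both kinds of step map solutions of the constrained hierarchy to
solutions (`IsDB.isDressedCKP`, `IsAdjDB.isDressedCKP`). Hence every site of the orbit satisfies the
Wilson-Sato equations and the constraint. The coefficient of `D⁻¹` in the Wilson-Sato equation for
`t_r` says `∂_r ∂ₓ ln τ = Res L` (`IsDressedCKP.ddlog_tau`), and the constraint gives `Res L = ∑ Φ_i
Ψ_i`. At a site with `n, k ≥ 1` the DB step entering it has set `Ψ₁ = 1 / Φ₁^{(n-1,k)}`, and the
adjoint step entering it has set `Φ₂ = -1 / Ψ₂^{(n,k-1)}`. So the sum is a difference of two ratios.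
Since `τ` is multiplied by `Φ₁` or `Ψ₂` at each step, this is the Toda equation. The coupled
equations are its differences between neighbouring sites, because `∂ₓ ∂_r ln` turns products into
sums.

Invariance under a step with `T = f D f⁻¹`, `∂_n f = (L^{n/r})₊(f)`, comes from the identity `(T
L^{n/r} T⁻¹)₊ = T (L^{n/r})₊ T⁻¹ + (∂_n T) T⁻¹` (`plus_gauge_conj`, and `plus_adj_conj` for the
adjoint step). It is combined with integration by parts `D⁻¹ (∂ₓS) D⁻¹ = S D⁻¹ - D⁻¹ S` for the
potentials, where `∂ₓ S(Φ, Ψ) = Φ Ψ`.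

Actions on functions are expressed as residues, `A₊(f) = Res (A f D⁻¹)` and `(A₊)*(g) = Res (D⁻¹ g
A)` (`plusApply_eq`, `adjPlusApply_eq`). All arguments then stay inside the operator ring, and no
formal adjoint of an operator is needed.

The Sato formula for all coefficients of `W` in terms of `τ` is used only at the initial site. What
is propagated is its first nontrivial coefficient, `-∂ₓ ln τ`. -/

namespace PDO

variable {R : Type*} [CommRing R] [Algebra ℚ R] {d : Derivation ℚ R R}

/-! ### Orders, differential operators and the splitting into `A₊` and `A₋`. -/

/-- `A` has order at most `k`. -/
def OrdLE (A : PDO d) (k : ℤ) : Prop := ∀ n, k < n → A.coeff n = 0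

/-- `A` is a differential operator. -/
def IsDiff (A : PDO d) : Prop := ∀ n, n < 0 → A.coeff n = 0

theorem coeff_sub (A B : PDO d) (n : ℤ) : (A - B).coeff n = A.coeff n - B.coeff n := by
  rw [sub_eq_add_neg, coeff_add, coeff_neg, sub_eq_add_neg]

theorem OrdLE.mono {A : PDO d} {j k : ℤ} (h : OrdLE A j) (hjk : j ≤ k) : OrdLE A k :=
  fun n hn => h n (lt_of_le_of_lt hjk hn)

theorem OrdLE.add {A B : PDO d} {k : ℤ} (hA : OrdLE A k) (hB : OrdLE B k) : OrdLE (A + B) k :=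
  fun n hn => by rw [coeff_add, hA n hn, hB n hn, add_zero]

theorem OrdLE.neg {A : PDO d} {k : ℤ} (hA : OrdLE A k) : OrdLE (-A) k :=
  fun n hn => by rw [coeff_neg, hA n hn, neg_zero]

theorem OrdLE.sub {A B : PDO d} {k : ℤ} (hA : OrdLE A k) (hB : OrdLE B k) : OrdLE (A - B) k :=
  fun n hn => by rw [coeff_sub, hA n hn, hB n hn, sub_zero]

theorem OrdLE.mul {A B : PDO d} {j k : ℤ} (hA : OrdLE A j) (hB : OrdLE B k) :
    OrdLE (A * B) (j + k) := by
  intro n hn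
  refine finsum_eq_zero_of_forall_eq_zero fun x => ?_
  by_cases h : j < x.1
  · rw [hA _ h, zero_mul, smul_zero]
  · rw [hB _ (by omega), iterate_map_zero, mul_zero, smul_zero]

theorem OrdLE.sum {ι : Type*} {s : Finset ι} {A : ι → PDO d} {k : ℤ}
    (h : ∀ i ∈ s, OrdLE (A i) k) : OrdLE (∑ i ∈ s, A i) k :=
  Finset.sum_induction A (fun B => OrdLE B k) (fun _ _ => OrdLE.add) (fun _ _ => rfl) h

theorem ordLE_monomial (p : ℤ) (f : R) : OrdLE (monomial d p f) p :=
  fun _ hn => if_neg hn.ne'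

theorem ordLE_mulOp (f : R) : OrdLE (mulOp d f) 0 := ordLE_monomial 0 f

theorem ordLE_D : OrdLE (D d : PDO d) 1 := ordLE_monomial 1 1

theorem ordLE_Dinv : OrdLE (Dinv d) (-1) := ordLE_monomial (-1) 1

theorem IsDiff.add {A B : PDO d} (hA : IsDiff A) (hB : IsDiff B) : IsDiff (A + B) :=
  fun n hn => by rw [coeff_add, hA n hn, hB n hn, add_zero]

theorem IsDiff.sub {A B : PDO d} (hA : IsDiff A) (hB : IsDiff B) : IsDiff (A - B) :=
  fun n hn => by rw [coeff_sub, hA n hn, hB n hn, sub_zero]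

theorem choose_eq_zero {p : ℤ} {i : ℕ} (hp : 0 ≤ p) (hi : p < i) : (Ring.choose p i : ℤ) = 0 := by
  lift p to ℕ using hp
  rw [Ring.choose_natCast, Nat.choose_eq_zero_of_lt (by exact_mod_cast hi), Nat.cast_zero]

/-- For `p ≥ 0` the binomial `(p choose i)` vanishes when `i > p`, so the Leibniz expansion of `Dᵖ
f` stops before negative powers. -/
theorem IsDiff.mul {A B : PDO d} (hA : IsDiff A) (hB : IsDiff B) : IsDiff (A * B) := by
  intro n hn
  refine finsum_eq_zero_of_forall_eq_zero fun x => ?_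
  by_cases hp : x.1 < 0
  · rw [hA _ hp, zero_mul, smul_zero]
  · by_cases hi : x.1 < x.2
    · rw [choose_eq_zero (not_lt.mp hp) hi, zero_smul]
    · rw [hB _ (by omega), iterate_map_zero, mul_zero, smul_zero]

theorem isDiff_mulOp (f : R) : IsDiff (mulOp d f) := fun _ hn => if_neg hn.ne

theorem isDiff_D : IsDiff (D d : PDO d) := fun _ hn => if_neg (by omega)

theorem isDiff_plus (A : PDO d) : IsDiff (plus A) := fun _ hn => if_neg (not_le.mpr hn)

theorem ordLE_minus (A : PDO d) : OrdLE (minus A) (-1) := fun _ hn => if_neg (by omega)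

theorem plus_add_minus (A : PDO d) : plus A + minus A = A := by
  ext n
  rw [coeff_add]
  by_cases h : 0 ≤ n
  · simp [plus, minus, h, not_lt.mpr h]
  · simp [plus, minus, h, not_le.mp h]

theorem minus_eq_sub (A : PDO d) : minus A = A - plus A :=
  eq_sub_of_add_eq' (plus_add_minus A)

theorem plus_eq_of_add {A B C : PDO d} (hB : IsDiff B) (hC : OrdLE C (-1)) (h : A = B + C) :
    plus A = B := by
  subst h
  ext n
  by_cases hn : 0 ≤ n
  · simp [plus, hn, hC n (by omega)]
  · simp [plus, hn, hB n (by omega)]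

/-- Uniqueness of the splitting: later projections are computed by exhibiting a decomposition of
this shape. -/
theorem minus_eq_of_add {A B C : PDO d} (hB : IsDiff B) (hC : OrdLE C (-1)) (h : A = B + C) :
    minus A = C := by
  rw [minus_eq_sub, plus_eq_of_add hB hC h, h, add_sub_cancel_left]

theorem eq_mulOp_of_isDiff_of_ordLE {A : PDO d} (hA : IsDiff A) (hA' : OrdLE A 0) :
    A = mulOp d (A.coeff 0) := by
  ext n
  rw [mulOp, coeff_monomial]
  rcases lt_trichotomy n 0 with h | rfl | h
  · rw [hA n h, if_neg h.ne]
  · rw [if_pos rfl]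
  · rw [hA' n h, if_neg h.ne']

/-! ### Multiplication operators and right multiplication by `D` and `D⁻¹`. -/

theorem mulOp_mul (f g : R) : mulOp d (f * g) = mulOp d f * mulOp d g := by
  ext n
  rw [mulOp, mulOp, coeff_zero_monomial_mul, mulOp, coeff_monomial, coeff_monomial, mul_ite,
    mul_zero]

theorem mulOp_one : mulOp d (1 : R) = 1 := rfl

theorem mulOp_zero : mulOp d (0 : R) = 0 := by
  ext n; rw [mulOp, coeff_monomial, ite_self]; rfl

theorem mulOp_add (f g : R) : mulOp d (f + g) = mulOp d f + mulOp d g := by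
  ext n
  simp only [mulOp, coeff_monomial, coeff_add]
  split_ifs <;> simp

theorem mulOp_neg (f : R) : mulOp d (-f) = -mulOp d f := by
  ext n
  simp only [mulOp, coeff_monomial, coeff_neg]
  split_ifs <;> simp

theorem mulOp_sub (f g : R) : mulOp d (f - g) = mulOp d f - mulOp d g := by
  rw [sub_eq_add_neg, mulOp_add, mulOp_neg, sub_eq_add_neg]

theorem mulOp_sum {ι : Type*} (s : Finset ι) (f : ι → R) :
    mulOp d (∑ i ∈ s, f i) = ∑ i ∈ s, mulOp d (f i) :=
  map_sum (⟨⟨mulOp d, mulOp_zero⟩, mulOp_add⟩ : R →+ PDO d) f s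

theorem coeff_mulOp_mul (f : R) (A : PDO d) (n : ℤ) :
    (mulOp d f * A).coeff n = f * A.coeff n := coeff_zero_monomial_mul f A n

theorem coeff_mul_D (A : PDO d) (n : ℤ) : (A * (D d : PDO d)).coeff n = A.coeff (n - 1) :=
  coeff_mul_monomial_one A 1 n

theorem coeff_mul_Dinv (A : PDO d) (n : ℤ) : (A * Dinv d).coeff n = A.coeff (n + 1) := by
  have := coeff_mul_monomial_one A (-1) n
  rwa [sub_neg_eq_add] at this

theorem D_mul_Dinv : (D d : PDO d) * Dinv d = 1 := (D d).mul_inv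

theorem Dinv_mul_D : Dinv d * (D d : PDO d) = 1 := (D d).inv_mul

/-! ### Time derivatives of operators and commutation with `D`. -/

/-- A derivation of the coefficients, acting on operators coefficientwise. -/
def tmap (e : Derivation ℚ R R) : PDO d →+ PDO d where
  toFun A := ⟨fun n => e (A.coeff n), by
    obtain ⟨N, hN⟩ := A.bdd
    exact ⟨N, fun n hn => by rw [hN n hn, map_zero]⟩⟩
  map_zero' := by ext n; exact map_zero e
  map_add' A B := by ext n; exact map_add e _ _

theorem coeff_tmap (e : Derivation ℚ R R) (A : PDO d) (n : ℤ) :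
    (tmap e A).coeff n = e (A.coeff n) := rfl

theorem tmap_mul {e : Derivation ℚ R R} (he : ∀ f, e (d f) = d (e f)) (A B : PDO d) :
    tmap e (A * B) = tmap e A * B + A * tmap e B := by
  have hit : ∀ (k : ℕ) (f : R), e ((⇑d)^[k] f) = (⇑d)^[k] (e f) := by
    intro k f
    induction k with
    | zero => rfl
    | succ k ih => rw [Function.iterate_succ_apply', he, ih, Function.iterate_succ_apply']
  have hterm : ∀ (p m : ℤ) (f g : R),
      e (mulTerm d p m f g) = mulTerm d p m (e f) g + mulTerm d p m f (e g) := by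
    intro p m f g
    unfold mulTerm
    split_ifs
    · rw [map_zsmul, e.leibniz, hit, smul_eq_mul, smul_eq_mul, ← smul_add]
      congr 1; ring
    · simp
  obtain ⟨h, -, hA, hB, -⟩ := exists_hi A B 0
  have hA' : ∀ p, h < p → (tmap e A).coeff p = 0 := fun p hp => by
    rw [coeff_tmap, hA p hp, map_zero]
  have hB' : ∀ p, h < p → (tmap e B).coeff p = 0 := fun p hp => by
    rw [coeff_tmap, hB p hp, map_zero]
  ext n
  rw [coeff_tmap, coeff_add, coeff_mul, coeff_mul, coeff_mul, mulCoeff_window hA hB le_rfl le_rfl,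
    mulCoeff_window hA' hB le_rfl le_rfl, mulCoeff_window hA hB' le_rfl le_rfl]
  simp only [map_sum, hterm, coeff_tmap, Finset.sum_add_distrib]

theorem tmap_mulOp (e : Derivation ℚ R R) (f : R) : tmap e (mulOp d f) = mulOp d (e f) := by
  ext n
  simp only [coeff_tmap, mulOp, coeff_monomial]
  split_ifs <;> simp

theorem tmap_monomial_one (e : Derivation ℚ R R) (p : ℤ) : tmap e (monomial d p 1) = 0 := by
  ext n
  simp only [coeff_tmap, coeff_monomial]
  split_ifs <;> simp

theorem tmap_D (e : Derivation ℚ R R) : tmap e (D d : PDO d) = 0 := tmap_monomial_one e 1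

theorem tmap_Dinv (e : Derivation ℚ R R) : tmap e (Dinv d) = 0 := tmap_monomial_one e (-1)

theorem tmap_one (e : Derivation ℚ R R) : tmap e (1 : PDO d) = 0 := tmap_monomial_one e 0

theorem D_mul (A : PDO d) : (D d : PDO d) * A = A * (D d : PDO d) + tmap d A := by
  ext n
  rw [coeff_add, coeff_mul_D, coeff_tmap, coeff_mul, mulCoeff,
    finsum_eq_sum_of_support_subset (s := {((1, 0) : ℤ × ℕ), (1, 1)})]
  · rw [Finset.sum_pair (by simp)]
    simp [D, coeff_monomial]
  · rintro ⟨p, i⟩ hx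
    rw [Function.mem_support] at hx
    have hp : p = 1 := by
      by_contra hp
      exact hx (by simp [D, coeff_monomial, hp])
    subst hp
    have hi : ¬ (1 : ℤ) < i := fun hi => hx (by rw [choose_eq_zero (by norm_num) hi, zero_smul])
    have : i = 0 ∨ i = 1 := by omega
    rcases this with rfl | rfl <;> simp

theorem D_mul_mulOp (f : R) :
    (D d : PDO d) * mulOp d f = mulOp d f * (D d : PDO d) + mulOp d (d f) := by
  rw [D_mul, tmap_mulOp]

theorem mulOp_mul_D (f : R) :
    mulOp d f * (D d : PDO d) = (D d : PDO d) * mulOp d f - mulOp d (d f) := by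
  rw [D_mul_mulOp, add_sub_cancel_right]

/-- Integration by parts: `D⁻¹ (d S) D⁻¹ = S D⁻¹ - D⁻¹ S`. -/
theorem Dinv_mulOp_Dinv (S : R) :
    Dinv d * mulOp d (d S) * Dinv d = mulOp d S * Dinv d - Dinv d * mulOp d S := by
  have h : mulOp d (d S) = (D d : PDO d) * mulOp d S - mulOp d S * (D d : PDO d) := by
    rw [D_mul_mulOp, add_sub_cancel_left]
  rw [h, mul_sub, sub_mul, ← mul_assoc, Dinv_mul_D, one_mul, ← mul_assoc (Dinv d),
    mul_assoc (Dinv d * mulOp d S), D_mul_Dinv, mul_one]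

/-! ### Residues -/

theorem res_add (A B : PDO d) : res (A + B) = res A + res B := rfl

theorem res_neg (A : PDO d) : res (-A) = -res A := rfl

theorem res_sub (A B : PDO d) : res (A - B) = res A - res B := coeff_sub A B (-1)

theorem res_mulOp_mul (f : R) (A : PDO d) : res (mulOp d f * A) = f * res A :=
  coeff_mulOp_mul f A (-1)

theorem res_eq_zero_of_isDiff {A : PDO d} (h : IsDiff A) : res A = 0 := h _ (by norm_num)

theorem res_eq_zero_of_ordLE {A : PDO d} (h : OrdLE A (-2)) : res A = 0 := h _ (by norm_num)

/-- A term `aₚ Dᵖ f` reaches order `-1` with binomial `(p choose p + 1)`, which vanishes for `p ≥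
0`; only `p = -1` is left. -/
theorem res_mul_mulOp (A : PDO d) (f : R) : res (A * mulOp d f) = res A * f := by
  rw [res, coeff_mul, mulCoeff, finsum_eq_single _ ((-1, 0) : ℤ × ℕ)]
  · simp [mulOp, coeff_monomial, res]
  · rintro ⟨p, i⟩ h
    simp only [mulOp, coeff_monomial]
    split_ifs with hi
    · by_cases hp : 0 ≤ p
      · rw [choose_eq_zero hp (by omega), zero_smul]
      · exact absurd (by simp only [Prod.mk.injEq]; omega) h
    · simp

theorem finsum_eq_finsum_comp {α β M : Type*} [AddCommMonoid M] {g : β → α}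
    (hg : Function.Injective g) (f : α → M) (h : ∀ x, f x ≠ 0 → x ∈ Set.range g) :
    ∑ᶠ x, f x = ∑ᶠ i, f (g i) := by
  rw [← finsum_mem_range hg, ← finsum_mem_univ f]
  exact finsum_mem_inter_support_eq' f _ _ fun x hx => by simp [h x hx]

/-- The order-zero term of `Dⁿ f` is the `n`-th derivative of `f`, and negative powers have none.
Eigenfunction equations thereby become identities between operators. -/
theorem plusApply_eq (A : PDO d) (f : R) : plusApply A f = res (A * mulOp d f * Dinv d) := by
  rw [res, coeff_mul_Dinv, coeff_mul, mulCoeff,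
    finsum_eq_finsum_comp (g := fun n : ℕ => ((n, n) : ℤ × ℕ)) (fun a b h => by simpa using h)]
  · refine finsum_congr fun n => ?_
    simp [mulOp, coeff_monomial, Ring.choose_natCast]
  · rintro ⟨p, i⟩ h
    have : (-1 : ℤ) + 1 - p + i = 0 := by
      by_contra hc
      have hc' : ¬ (-p + (i : ℤ) = 0) := by omega
      exact h (by simp [mulOp, coeff_monomial, hc'])
    exact ⟨i, by rw [Prod.mk.injEq]; exact ⟨by omega, rfl⟩⟩

theorem choose_neg_one (i : ℕ) : (Ring.choose (-1 : ℤ) i : ℤ) = (-1) ^ i := by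
  rw [Ring.choose_neg', Ring.multichoose_one, Int.negOnePow_def, zpow_natCast, Units.smul_def,
    smul_eq_mul, mul_one, Units.val_pow_eq_pow_val, Units.val_neg, Units.val_one]

/-- In `D⁻¹ h = ∑ (-1)ⁱ (dⁱ h) D^{-1-i}` with `h = g aₙ`, followed by `Dⁿ`, the residue picks out `i
= n`. This stands in for the formal adjoint. -/
theorem adjPlusApply_eq (A : PDO d) (g : R) :
    adjPlusApply A g = res (Dinv d * (mulOp d g * A)) := by
  rw [res, coeff_mul, mulCoeff,
    finsum_eq_finsum_comp (g := fun n : ℕ => ((-1, n) : ℤ × ℕ)) (fun a b h => by simpa using h)]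
  · refine finsum_congr fun n => ?_
    rw [choose_neg_one, coeff_mulOp_mul, sub_self, zero_add, Dinv, coeff_monomial, if_pos rfl,
      one_mul, mul_comm g, zsmul_eq_mul]
    push_cast
    rfl
  · rintro ⟨p, i⟩ h
    have : p = -1 := by
      by_contra hc
      exact h (by simp [Dinv, coeff_monomial, hc])
    exact ⟨i, by rw [this]⟩

theorem minus_mul_Dinv {A : PDO d} (hA : IsDiff A) :
    minus (A * Dinv d) = mulOp d (res (A * Dinv d)) * Dinv d := by
  ext n
  rw [coeff_mulOp_mul, Dinv, coeff_monomial]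
  simp only [minus]
  split_ifs with h1 h2 h2
  · rw [h2, mul_one]; rfl
  · have := coeff_mul_Dinv A n
    rw [Dinv] at this
    rw [this, hA _ (by omega), mul_zero]
  · omega
  · rw [mul_zero]

/-- With `B = D⁻¹ A`, the operator `D B₋ = A - D B₊` is differential and of order at most zero, so
it is a function, namely `Res B`. -/
theorem minus_Dinv_mul {A : PDO d} (hA : IsDiff A) :
    minus (Dinv d * A) = Dinv d * mulOp d (res (Dinv d * A)) := by
  set B := Dinv d * A with hB
  have h1 : (D d : PDO d) * minus B = A - D d * plus B := by
    rw [minus_eq_sub, mul_sub, hB, ← mul_assoc, D_mul_Dinv, one_mul]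
  have h2 : IsDiff ((D d : PDO d) * minus B) := by
    rw [h1]; exact hA.sub (isDiff_D.mul (isDiff_plus B))
  have h3 := eq_mulOp_of_isDiff_of_ordLE h2 (ordLE_D.mul (ordLE_minus B))
  have h4 : ((D d : PDO d) * minus B).coeff 0 = res B := by
    rw [D_mul, coeff_add, coeff_mul_D, coeff_tmap, ordLE_minus B 0 (by norm_num), map_zero,
      add_zero]
    rfl
  rw [← h4, ← h3, ← mul_assoc, Dinv_mul_D, one_mul]

end PDO

namespace PDO

variable {R : Type*} [CommRing R] [Algebra ℚ R] {d : Derivation ℚ R R}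

theorem res_Dinv : res (Dinv d) = 1 := (coeff_monomial (-1) 1 (-1)).trans (if_pos rfl)

theorem res_minus (A : PDO d) : res (minus A) = res A := by
  simp [res, minus]

theorem ordLE_sub_one {A : PDO d} (h0 : OrdLE A 0) (h1 : A.coeff 0 = 1) : OrdLE (A - 1) (-1) := by
  intro n hn
  rw [coeff_sub, coeff_one]
  rcases eq_or_ne n 0 with rfl | hn0
  · rw [h1, if_pos rfl, sub_self]
  · rw [h0 n (by omega), if_neg hn0, sub_self]

theorem res_sum {ι : Type*} (s : Finset ι) (A : ι → PDO d) :
    res (∑ i ∈ s, A i) = ∑ i ∈ s, res (A i) :=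
  map_sum (⟨⟨res, rfl⟩, res_add⟩ : PDO d →+ R) A s

theorem eq_plus_add_mulOp_mul_Dinv {A : PDO d} (hA : IsDiff A) (f : R) :
    A * mulOp d f * Dinv d =
      plus (A * mulOp d f * Dinv d) + mulOp d (res (A * mulOp d f * Dinv d)) * Dinv d := by
  rw [← minus_mul_Dinv (hA.mul (isDiff_mulOp f)), plus_add_minus]

theorem eq_plus_add_Dinv_mul_mulOp {A : PDO d} (hA : IsDiff A) (f : R) :
    Dinv d * (mulOp d f * A) =
      plus (Dinv d * (mulOp d f * A)) + Dinv d * mulOp d (res (Dinv d * (mulOp d f * A))) := by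
  rw [← minus_Dinv_mul ((isDiff_mulOp f).mul hA), plus_add_minus]

/-- The discarded term `A₋ f D⁻¹` has order at most `-2`. -/
theorem res_plus_mul_mulOp_mul_Dinv (A : PDO d) (f : R) :
    res (plus A * mulOp d f * Dinv d) = res (A * mulOp d f * Dinv d) := by
  conv_rhs => rw [← plus_add_minus A, add_mul, add_mul, res_add]
  rw [res_eq_zero_of_ordLE (((ordLE_minus A).mul (ordLE_mulOp f)).mul ordLE_Dinv), add_zero]

theorem res_Dinv_mul_mulOp_mul_plus (A : PDO d) (f : R) :
    res (Dinv d * (mulOp d f * plus A)) = res (Dinv d * (mulOp d f * A)) := by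
  conv_rhs => rw [← plus_add_minus A, mul_add, mul_add, res_add]
  rw [res_eq_zero_of_ordLE (ordLE_Dinv.mul ((ordLE_mulOp f).mul (ordLE_minus A))), add_zero]

/-! ### Gauge operators: with `f g = 1`, `T = f D g`, and up to sign its adjoint `g D f`. -/

/-- The first-order operator `f D g`. -/
noncomputable def gaugeD (d : Derivation ℚ R R) (f g : R) : PDO d :=
  mulOp d f * (D d : PDO d) * mulOp d g

/-- The operator `f D⁻¹ g`. -/
noncomputable def gaugeDinv (d : Derivation ℚ R R) (f g : R) : PDO d :=
  mulOp d f * Dinv d * mulOp d g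

theorem ordLE_gaugeD (f g : R) : OrdLE (gaugeD d f g) 1 :=
  ((ordLE_mulOp f).mul ordLE_D).mul (ordLE_mulOp g)

theorem ordLE_gaugeDinv (f g : R) : OrdLE (gaugeDinv d f g) (-1) :=
  ((ordLE_mulOp f).mul ordLE_Dinv).mul (ordLE_mulOp g)

theorem isDiff_gaugeD (f g : R) : IsDiff (gaugeD d f g) :=
  ((isDiff_mulOp f).mul isDiff_D).mul (isDiff_mulOp g)

theorem gaugeD_mul_gaugeDinv {f g : R} (hfg : f * g = 1) :
    gaugeD d f g * gaugeDinv d f g = 1 := by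
  calc gaugeD d f g * gaugeDinv d f g
      = mulOp d f * (D d * (mulOp d g * mulOp d f) * Dinv d) * mulOp d g := by
        simp only [gaugeD, gaugeDinv, mul_assoc]
    _ = 1 := by
        rw [← mulOp_mul, mul_comm g, hfg, mulOp_one, mul_one, D_mul_Dinv, mul_one, ← mulOp_mul,
          hfg, mulOp_one]

theorem gaugeDinv_mul_gaugeD {f g : R} (hfg : f * g = 1) :
    gaugeDinv d f g * gaugeD d f g = 1 := by
  calc gaugeDinv d f g * gaugeD d f g
      = mulOp d f * (Dinv d * (mulOp d g * mulOp d f) * D d) * mulOp d g := by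
        simp only [gaugeD, gaugeDinv, mul_assoc]
    _ = 1 := by
        rw [← mulOp_mul, mul_comm g, hfg, mulOp_one, mul_one, Dinv_mul_D, mul_one, ← mulOp_mul,
          hfg, mulOp_one]

/-- `f D g` as a unit with inverse `f D⁻¹ g`, when `f g = 1`. -/
noncomputable def gaugeUnit (d : Derivation ℚ R R) {f g : R} (hfg : f * g = 1) : (PDO d)ˣ :=
  ⟨gaugeD d f g, gaugeDinv d f g, gaugeD_mul_gaugeDinv hfg, gaugeDinv_mul_gaugeD hfg⟩

theorem gaugeD_eq {f g : R} (hfg : f * g = 1) :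
    gaugeD d f g = (D d : PDO d) + mulOp d (f * d g) := by
  rw [gaugeD, mul_assoc, D_mul_mulOp, mul_add, ← mul_assoc, ← mulOp_mul, hfg, mulOp_one, one_mul,
    ← mulOp_mul]

theorem derivation_inv_eq (e : Derivation ℚ R R) {f g : R} (hfg : f * g = 1) :
    e g = -(e f * g) * g := by
  have h : f * e g + g * e f = 0 := by
    have := congrArg e hfg
    rwa [e.leibniz, e.map_one_eq_zero, smul_eq_mul, smul_eq_mul] at this
  linear_combination g * h - e g * hfg

/-- Here `f * d g` is minus the logarithmic derivative of `f`, and mixed logarithmic derivatives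
agree. -/
theorem derivation_mul_derivation_inv (e : Derivation ℚ R R)
    (he : ∀ h, e (d h) = d (e h)) {f g : R} (hfg : f * g = 1) :
    e (f * d g) = -d (e f * g) := by
  have h1 := derivation_inv_eq e hfg
  have h2 : f * d g = -(d f * g) := by
    linear_combination f * derivation_inv_eq d hfg - d f * g * hfg
  rw [h2, map_neg]
  simp only [Derivation.leibniz, smul_eq_mul, he, h1, derivation_inv_eq d hfg]
  ring

/-- As `T = D - d ln f`, its time derivative is a mere function, so `(∂T) T⁻¹` has negative order.
-/
theorem tmap_gaugeD {e : Derivation ℚ R R} (he : ∀ h, e (d h) = d (e h)) {f g : R}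
    (hfg : f * g = 1) : tmap e (gaugeD d f g) = -mulOp d (d (e f * g)) := by
  rw [gaugeD_eq hfg, map_add, tmap_D, zero_add, tmap_mulOp,
    derivation_mul_derivation_inv e he hfg, mulOp_neg]

/-- The time derivative of `T(h) = f d(h / f)`. -/
theorem derivation_gauge_apply {e : Derivation ℚ R R} (he : ∀ h, e (d h) = d (e h)) {f g : R}
    (hfg : f * g = 1) (h : R) :
    e (f * d (h * g)) = f * d (e h * g) - d (e f * g) * h := by
  -- The logarithmic derivative is made opaque, so that `e f = u * f` and `e g = -u * g` and the
  -- Leibniz rule does not unfold `d u`.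
  have hu : ∃ u, u = e f * g := ⟨_, rfl⟩
  obtain ⟨u, hu⟩ := hu
  have h1 : e g = -u * g := by rw [hu]; exact derivation_inv_eq e hfg
  have h2 : e f = u * f := by rw [hu]; linear_combination -(e f) * hfg
  rw [← hu, e.leibniz, he, e.leibniz, h1, h2]
  simp only [Derivation.leibniz, smul_eq_mul, map_add, map_neg]
  linear_combination (-(h * d u)) * hfg

/-- As an operator, `T h` is `h D` plus the function `T(h)`. The transformed function thus appears
as the residue of `T h D⁻¹`. -/
theorem gaugeD_mul_mulOp_mul_Dinv {f g : R} (hfg : f * g = 1) (h : R) :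
    gaugeD d f g * mulOp d h * Dinv d = mulOp d h + mulOp d (f * d (h * g)) * Dinv d := by
  calc gaugeD d f g * mulOp d h * Dinv d
      = mulOp d f * (D d * mulOp d (g * h)) * Dinv d := by
        rw [mulOp_mul]; simp only [gaugeD, mul_assoc]
    _ = mulOp d (f * (g * h)) * (D d * Dinv d) + mulOp d (f * d (g * h)) * Dinv d := by
        rw [D_mul_mulOp, mulOp_mul f, mulOp_mul f]; noncomm_ring
    _ = _ := by
        rw [D_mul_Dinv, mul_one, ← mul_assoc, hfg, one_mul, mul_comm g]

/-- The left-handed counterpart, for adjoint eigenfunctions: `g D f` is `-T*`, whence the sign. -/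
theorem Dinv_mul_mulOp_mul_gaugeD {f g : R} (hfg : f * g = 1) (h : R) :
    Dinv d * mulOp d h * gaugeD d g f = mulOp d h - Dinv d * mulOp d (f * d (h * g)) := by
  calc Dinv d * mulOp d h * gaugeD d g f
      = Dinv d * (mulOp d (h * g) * D d) * mulOp d f := by
        rw [mulOp_mul]; simp only [gaugeD, mul_assoc]
    _ = (Dinv d * D d) * mulOp d (h * g * f) - Dinv d * mulOp d (d (h * g) * f) := by
        rw [mulOp_mul_D, mulOp_mul _ f, mulOp_mul _ f]; noncomm_ring
    _ = _ := by
        rw [Dinv_mul_D, one_mul, mul_assoc, mul_comm g, hfg, mul_one, mul_comm f]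

/-! ### Conjugation by `f D f⁻¹` -/

section Darboux

variable {f g : R}

/-- Only the term `A(f) D⁻¹` of `A f D⁻¹` is not differential, and `T` turns it into a function plus
`T(A(f)) D⁻¹`. -/
theorem minus_gauge_conj (hfg : f * g = 1) {A : PDO d} (hA : IsDiff A) :
    minus (gaugeD d f g * A * gaugeDinv d f g) =
      mulOp d (f * d (res (A * mulOp d f * Dinv d) * g)) * Dinv d * mulOp d g := by
  set a := res (A * mulOp d f * Dinv d) with ha
  refine minus_eq_of_add (B := gaugeD d f g * plus (A * mulOp d f * Dinv d) * mulOp d g +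
    mulOp d a * mulOp d g) ?_ ?_ ?_
  · exact (((isDiff_gaugeD f g).mul (isDiff_plus _)).mul (isDiff_mulOp g)).add
      ((isDiff_mulOp a).mul (isDiff_mulOp g))
  · exact ((ordLE_mulOp _).mul ordLE_Dinv).mul (ordLE_mulOp g)
  · calc gaugeD d f g * A * gaugeDinv d f g
        = gaugeD d f g * (A * mulOp d f * Dinv d) * mulOp d g := by
          simp only [gaugeDinv, mul_assoc]
      _ = gaugeD d f g * plus (A * mulOp d f * Dinv d) * mulOp d g +
          (gaugeD d f g * mulOp d a * Dinv d) * mulOp d g := by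
          conv_lhs => rw [eq_plus_add_mulOp_mul_Dinv hA f, ← ha]
          noncomm_ring
      _ = _ := by rw [gaugeD_mul_mulOp_mul_Dinv hfg]; noncomm_ring

variable {e : Derivation ℚ R R}

/-- `(T L T⁻¹)₊ = T L₊ T⁻¹ + (∂T) T⁻¹` for `T = f D f⁻¹` with `∂f = L₊(f)`. -/
theorem plus_gauge_conj (he : ∀ h, e (d h) = d (e h)) (hfg : f * g = 1) {L : PDO d}
    (hf : e f = res (plus L * mulOp d f * Dinv d)) :
    plus (gaugeD d f g * L * gaugeDinv d f g) =
      gaugeD d f g * plus L * gaugeDinv d f g + tmap e (gaugeD d f g) * gaugeDinv d f g := by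
  -- Both sides are `-(f d(∂f / f)) D⁻¹ f⁻¹`: the extra term cancels exactly the negative part
  -- created by the conjugation, while `T L₋ T⁻¹` has order at most `-1`.
  have h1 : tmap e (gaugeD d f g) * gaugeDinv d f g =
      -minus (gaugeD d f g * plus L * gaugeDinv d f g) := by
    rw [minus_gauge_conj hfg (isDiff_plus L), ← hf, tmap_gaugeD he hfg, gaugeDinv, mul_comm f,
      mulOp_mul]
    noncomm_ring
  have h2 := plus_add_minus (gaugeD d f g * plus L * gaugeDinv d f g)
  rw [h1, ← sub_eq_add_neg, minus_eq_sub, sub_sub_cancel]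
  refine plus_eq_of_add (isDiff_plus _) (C := minus (gaugeD d f g * plus L * gaugeDinv d f g) +
    gaugeD d f g * minus L * gaugeDinv d f g) ((ordLE_minus _).add ?_) ?_
  · exact ((ordLE_gaugeD f g).mul (ordLE_minus L)).mul (ordLE_gaugeDinv f g)
  · rw [← add_assoc, h2]
    conv_lhs => rw [← plus_add_minus L]
    noncomm_ring

/-- Differentiating `T W D⁻¹` yields the factor `(∂T) T⁻¹ - T L₋ T⁻¹`, which `plus_gauge_conj`
identifies with `-(T L T⁻¹)₋`. -/
theorem gauge_wilson_sato (he : ∀ h, e (d h) = d (e h)) (hfg : f * g = 1) {L W : PDO d}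
    (hf : e f = res (plus L * mulOp d f * Dinv d)) (hW : tmap e W = -(minus L * W)) :
    tmap e (gaugeD d f g * W * Dinv d) =
      -(minus (gaugeD d f g * L * gaugeDinv d f g) * (gaugeD d f g * W * Dinv d)) := by
  have h := gaugeDinv_mul_gaugeD (d := d) hfg
  rw [minus_eq_sub, plus_gauge_conj he hfg hf, tmap_mul he, tmap_mul he, tmap_Dinv, hW,
    minus_eq_sub]
  set T := gaugeD d f g
  set U := gaugeDinv d f g
  calc _ = (tmap e T * W - T * (L - plus L) * W) * Dinv d := by noncomm_ring
    _ = (tmap e T * (U * T) * W - T * (L - plus L) * (U * T) * W) * Dinv d := by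
      rw [h, mul_one, mul_one]
    _ = _ := by noncomm_ring

/-- Replacing `T(h) D⁻¹` by `T h D⁻¹` changes it by a function, which has no residue against a
differential operator. Then `T⁻¹ T` cancels, leaving `T(∂h)` plus the action of `∂T` on `h`. -/
theorem gauge_eigen (he : ∀ h, e (d h) = d (e h)) (hfg : f * g = 1) {L : PDO d}
    (hf : e f = res (plus L * mulOp d f * Dinv d)) {h : R}
    (hh : e h = res (plus L * mulOp d h * Dinv d)) :
    e (f * d (h * g)) = res (plus (gaugeD d f g * L * gaugeDinv d f g) *
      mulOp d (f * d (h * g)) * Dinv d) := by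
  have h1 : mulOp d (f * d (h * g)) * Dinv d = gaugeD d f g * mulOp d h * Dinv d - mulOp d h := by
    rw [gaugeD_mul_mulOp_mul_Dinv hfg, add_sub_cancel_left]
  rw [mul_assoc, h1, mul_sub, res_sub,
    res_eq_zero_of_isDiff ((isDiff_plus _).mul (isDiff_mulOp h)), sub_zero,
    plus_gauge_conj he hfg hf]
  have h2 := gaugeDinv_mul_gaugeD (d := d) hfg
  have h3 : (gaugeD d f g * plus L * gaugeDinv d f g + tmap e (gaugeD d f g) * gaugeDinv d f g) *
      (gaugeD d f g * mulOp d h * Dinv d) =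
      gaugeD d f g * (plus L * mulOp d h * Dinv d) +
        tmap e (gaugeD d f g) * mulOp d h * Dinv d := by
    calc _ = gaugeD d f g * plus L * (gaugeDinv d f g * gaugeD d f g) * mulOp d h * Dinv d +
        tmap e (gaugeD d f g) * (gaugeDinv d f g * gaugeD d f g) * mulOp d h * Dinv d := by
          noncomm_ring
      _ = _ := by rw [h2]; noncomm_ring
  rw [h3, eq_plus_add_mulOp_mul_Dinv (isDiff_plus L) h, ← hh, mul_add, res_add, res_add,
    res_eq_zero_of_isDiff ((isDiff_gaugeD f g).mul (isDiff_plus _)), zero_add, ← mul_assoc,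
    gaugeD_mul_mulOp_mul_Dinv hfg, res_add, res_eq_zero_of_isDiff (isDiff_mulOp _), zero_add,
    res_mulOp_mul, tmap_gaugeD he hfg, neg_mul, neg_mul, res_neg,
    mul_assoc (mulOp d (d (e f * g))), res_mulOp_mul,
    res_mulOp_mul, derivation_gauge_apply he hfg]
  rw [res_Dinv]
  ring

/-- Since `d S = f h`, moving `D` to the left past `S` gives `D⁻¹ (S / f) T = S / f - D⁻¹ h`. The
two terms produce `∂f` and `∂S`; the contribution of `(∂T) T⁻¹` has order at most `-2`. -/
theorem gauge_adj_eigen (he : ∀ h, e (d h) = d (e h)) (hfg : f * g = 1) {L : PDO d}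
    (hf : e f = res (plus L * mulOp d f * Dinv d)) {h S : R} (hS : d S = f * h)
    (hS' : e S = res (Dinv d * mulOp d h * plus L * mulOp d f * Dinv d)) :
    e (g * S) = -res (Dinv d * (mulOp d (g * S) *
      plus (gaugeD d f g * L * gaugeDinv d f g))) := by
  have h0 : OrdLE (Dinv d * (mulOp d (g * S) * (tmap e (gaugeD d f g) * gaugeDinv d f g))) (-2) := by
    rw [tmap_gaugeD he hfg]
    exact ordLE_Dinv.mul ((ordLE_mulOp _).mul ((ordLE_mulOp _).neg.mul (ordLE_gaugeDinv f g)))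
  rw [plus_gauge_conj he hfg hf, mul_add, mul_add, res_add, res_eq_zero_of_ordLE h0, add_zero]
  have h1 : Dinv d * (mulOp d (g * S) * (gaugeD d f g * plus L * gaugeDinv d f g)) =
      mulOp d (S * g) * (plus L * mulOp d f * Dinv d) * mulOp d g -
      (Dinv d * mulOp d h * plus L * mulOp d f * Dinv d) * mulOp d g := by
    calc _ = Dinv d * (mulOp d (g * S * f) * D d) * mulOp d g * (plus L * mulOp d f * Dinv d) *
          mulOp d g := by
          rw [mulOp_mul _ f]; simp only [gaugeD, gaugeDinv, mul_assoc]
      _ = (Dinv d * D d) * mulOp d (S * g) * (plus L * mulOp d f * Dinv d) * mulOp d g -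
          Dinv d * mulOp d (f * h * g) * (plus L * mulOp d f * Dinv d) * mulOp d g := by
          rw [show g * S * f = S by linear_combination S * hfg, mulOp_mul_D, hS, mulOp_mul S g,
            mulOp_mul _ g]
          noncomm_ring
      _ = _ := by
          rw [Dinv_mul_D, one_mul, show f * h * g = h by linear_combination h * hfg]
          simp only [mul_assoc]
  rw [h1, res_sub, res_mul_mulOp, res_mul_mulOp, res_mulOp_mul, ← hf, ← hS', e.leibniz,
    derivation_inv_eq e hfg, smul_eq_mul, smul_eq_mul]
  ring

/-- In `φ_i D⁻¹ ψ_i T⁻¹` the product `ψ_i f` is `d (S i)`, so integration by parts splits the term.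
One half completes `L₊(f)` to `L(f)`, the other is the new pair `T(φ_i)`, `-S_i / f`. -/
theorem gauge_constraint {ι : Type*} [Fintype ι] (hfg : f * g = 1) {L : PDO d}
    {φ ψ S : ι → R} (hL : minus L = ∑ i, mulOp d (φ i) * Dinv d * mulOp d (ψ i))
    (hS : ∀ i, d (S i) = f * ψ i) :
    minus (gaugeD d f g * L * gaugeDinv d f g) =
      mulOp d (f * d ((res (L * mulOp d f * Dinv d) + ∑ i, φ i * S i) * g)) * Dinv d * mulOp d g -
      ∑ i, mulOp d (f * d (φ i * g)) * Dinv d * mulOp d (g * S i) := by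
  set a := res (L * mulOp d f * Dinv d) with ha
  have hterm : ∀ i, gaugeD d f g * (mulOp d (φ i) * Dinv d * mulOp d (ψ i)) * gaugeDinv d f g =
      mulOp d (f * d (φ i * S i * g)) * Dinv d * mulOp d g -
        mulOp d (f * d (φ i * g)) * Dinv d * mulOp d (g * S i) := by
    intro i
    calc _ = gaugeD d f g * mulOp d (φ i) * (Dinv d * mulOp d (d (S i)) * Dinv d) * mulOp d g := by
          rw [hS, mul_comm f, mulOp_mul]; simp only [gaugeDinv, mul_assoc]
      _ = (gaugeD d f g * mulOp d (φ i * S i) * Dinv d) * mulOp d g -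
          (gaugeD d f g * mulOp d (φ i) * Dinv d) * mulOp d (S i * g) := by
          rw [Dinv_mulOp_Dinv, mulOp_mul, mulOp_mul]; noncomm_ring
      _ = _ := by
          rw [gaugeD_mul_mulOp_mul_Dinv hfg, gaugeD_mul_mulOp_mul_Dinv hfg, mul_comm g,
            mulOp_mul (φ i), mulOp_mul (S i)]
          noncomm_ring
  have hsum : gaugeD d f g * minus L * gaugeDinv d f g =
      mulOp d (f * d ((∑ i, φ i * S i) * g)) * Dinv d * mulOp d g -
        ∑ i, mulOp d (f * d (φ i * g)) * Dinv d * mulOp d (g * S i) := by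
    rw [hL, Finset.mul_sum, Finset.sum_mul, Finset.sum_congr rfl fun i _ => hterm i,
      Finset.sum_sub_distrib, Finset.sum_mul, map_sum, Finset.mul_sum, mulOp_sum, Finset.sum_mul,
      Finset.sum_mul]
  refine minus_eq_of_add (isDiff_plus (gaugeD d f g * plus L * gaugeDinv d f g)) ?_ ?_
  · refine OrdLE.sub (((ordLE_mulOp _).mul ordLE_Dinv).mul (ordLE_mulOp g))
      (OrdLE.sum fun i _ => ?_)
    exact ((ordLE_mulOp _).mul ordLE_Dinv).mul (ordLE_mulOp _)
  · have h1 := minus_gauge_conj (d := d) hfg (isDiff_plus L)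
    rw [res_plus_mul_mulOp_mul_Dinv, ← ha] at h1
    calc _ = gaugeD d f g * plus L * gaugeDinv d f g + gaugeD d f g * minus L * gaugeDinv d f g := by
          rw [← add_mul, ← mul_add, plus_add_minus]
      _ = _ := by
          rw [hsum, add_mul a, map_add, mul_add, mulOp_add]
          conv_lhs => rw [← plus_add_minus (gaugeD d f g * plus L * gaugeDinv d f g), h1]
          noncomm_ring

/-- `L(f)` is an eigenfunction. -/
theorem lax_apply_eigen {ι : Type*} [Fintype ι] (he : ∀ h, e (d h) = d (e h)) {L P : PDO d}
    (hP : IsDiff P) {φ ψ S : ι → R}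
    (hL : minus L = ∑ i, mulOp d (φ i) * Dinv d * mulOp d (ψ i))
    (hLax : tmap e L = P * L - L * P) (hf : e f = res (P * mulOp d f * Dinv d))
    (hφ : ∀ i, e (φ i) = res (P * mulOp d (φ i) * Dinv d)) (hS : ∀ i, d (S i) = f * ψ i)
    (hS' : ∀ i, e (S i) = res (Dinv d * mulOp d (ψ i) * P * mulOp d f * Dinv d)) :
    e (res (L * mulOp d f * Dinv d) + ∑ i, φ i * S i) =
      res (P * mulOp d (res (L * mulOp d f * Dinv d) + ∑ i, φ i * S i) * Dinv d) := by
  set a := res (L * mulOp d f * Dinv d) with ha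
  set Q := plus (P * mulOp d f * Dinv d) with hQ
  have hPf : P * mulOp d f * Dinv d = Q + mulOp d (e f) * Dinv d := by
    rw [hf]; exact eq_plus_add_mulOp_mul_Dinv hP f
  -- The Lax equation leaves two corrections to the eigenfunction equation for `a`: `∑ φ_i ∂S_i`
  -- from `L Q` (`h2`) and `∑ (∂φ_i) S_i` from the negative part of `L f D⁻¹` (`h3`). Together they
  -- cancel the derivative of `∑ φ_i S_i`.
  have h1 : e a = res (P * (L * mulOp d f * Dinv d)) - res (L * Q) := by
    have : e a = res (tmap e (L * mulOp d f * Dinv d)) := rfl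
    rw [this, tmap_mul he, tmap_mul he, tmap_Dinv, tmap_mulOp, hLax, mul_zero, add_zero,
      ← res_sub]
    congr 1
    calc _ = P * (L * mulOp d f * Dinv d) - L * (P * mulOp d f * Dinv d) +
          L * mulOp d (e f) * Dinv d := by noncomm_ring
      _ = _ := by rw [hPf]; noncomm_ring
  have h2 : res (L * Q) = ∑ i, φ i * e (S i) := by
    rw [← plus_add_minus L, add_mul, res_add,
      res_eq_zero_of_isDiff ((isDiff_plus L).mul (isDiff_plus _)), zero_add, hL, Finset.sum_mul]
    rw [res_sum]
    refine Finset.sum_congr rfl fun i _ => ?_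
    rw [mul_assoc, mul_assoc, res_mulOp_mul, hS', ← mul_assoc, eq_sub_of_add_eq hPf.symm, mul_sub,
      res_sub, res_eq_zero_of_ordLE ((ordLE_Dinv.mul (ordLE_mulOp _)).mul
        ((ordLE_mulOp _).mul ordLE_Dinv)), sub_zero]
    simp only [mul_assoc]
  have hLf : minus (L * mulOp d f * Dinv d) = mulOp d (a + ∑ i, φ i * S i) * Dinv d -
      ∑ i, mulOp d (φ i) * Dinv d * mulOp d (S i) := by
    refine minus_eq_of_add (isDiff_plus (plus L * mulOp d f * Dinv d)) ?_ ?_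
    · exact ((ordLE_mulOp _).mul ordLE_Dinv).sub
        (OrdLE.sum fun i _ => ((ordLE_mulOp _).mul ordLE_Dinv).mul (ordLE_mulOp _))
    · have hterm : ∀ i, mulOp d (φ i) * Dinv d * mulOp d (ψ i) * mulOp d f * Dinv d =
          mulOp d (φ i * S i) * Dinv d - mulOp d (φ i) * Dinv d * mulOp d (S i) := by
        intro i
        calc _ = mulOp d (φ i) * (Dinv d * mulOp d (d (S i)) * Dinv d) := by
              rw [hS, mul_comm f, mulOp_mul]; simp only [mul_assoc]
          _ = _ := by rw [Dinv_mulOp_Dinv, mulOp_mul]; noncomm_ring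
      have hm : minus L * mulOp d f * Dinv d = mulOp d (∑ i, φ i * S i) * Dinv d -
          ∑ i, mulOp d (φ i) * Dinv d * mulOp d (S i) := by
        rw [hL, Finset.sum_mul, Finset.sum_mul, Finset.sum_congr rfl fun i _ => hterm i,
          Finset.sum_sub_distrib, mulOp_sum, Finset.sum_mul]
      have hp := eq_plus_add_mulOp_mul_Dinv (isDiff_plus L) f
      rw [res_plus_mul_mulOp_mul_Dinv, ← ha] at hp
      calc _ = plus L * mulOp d f * Dinv d + minus L * mulOp d f * Dinv d := by
            rw [← add_mul, ← add_mul, plus_add_minus]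
        _ = plus (plus L * mulOp d f * Dinv d) + mulOp d a * Dinv d +
            minus L * mulOp d f * Dinv d := by rw [← hp]
        _ = _ := by rw [hm, mulOp_add]; noncomm_ring
  have h3 : res (P * (L * mulOp d f * Dinv d)) =
      res (P * mulOp d (a + ∑ i, φ i * S i) * Dinv d) - ∑ i, e (φ i) * S i := by
    rw [← plus_add_minus (L * mulOp d f * Dinv d), mul_add, res_add,
      res_eq_zero_of_isDiff (hP.mul (isDiff_plus _)), zero_add, hLf, mul_sub, res_sub, mul_assoc,
      Finset.mul_sum, res_sum]
    congr 1
    refine Finset.sum_congr rfl fun i _ => ?_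
    rw [← mul_assoc, ← mul_assoc, res_mul_mulOp, hφ]
  rw [map_add, map_sum, h1, h2, h3]
  simp only [Derivation.leibniz, smul_eq_mul, Finset.sum_add_distrib]
  rw [Finset.sum_congr rfl fun i _ => mul_comm (S i) (e (φ i))]
  ring

end Darboux

end PDO

namespace PDO

variable {R : Type*} [CommRing R] [Algebra ℚ R] {d : Derivation ℚ R R}

/-! ### Conjugation by `f⁻¹ D⁻¹ f` -/

section AdjointDarboux

variable {f g : R}

/-- Mirror image of `minus_gauge_conj`: the nondifferential part of `D⁻¹ f A` is `D⁻¹ a`, and right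
multiplication by `g D f` turns it into a function minus `D⁻¹ T(a)`. -/
theorem minus_adj_conj (hfg : f * g = 1) {A : PDO d} (hA : IsDiff A) :
    minus (gaugeDinv d g f * A * gaugeD d g f) =
      -(mulOp d g * Dinv d * mulOp d (f * d (res (Dinv d * (mulOp d f * A)) * g))) := by
  set a := res (Dinv d * (mulOp d f * A)) with ha
  refine minus_eq_of_add (B := mulOp d g * plus (Dinv d * (mulOp d f * A)) * gaugeD d g f +
    mulOp d g * mulOp d a) ?_ ?_ ?_
  · exact (((isDiff_mulOp g).mul (isDiff_plus _)).mul (isDiff_gaugeD g f)).add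
      ((isDiff_mulOp g).mul (isDiff_mulOp a))
  · exact (((ordLE_mulOp _).mul ordLE_Dinv).mul (ordLE_mulOp _)).neg
  · calc gaugeDinv d g f * A * gaugeD d g f
        = mulOp d g * (Dinv d * (mulOp d f * A)) * gaugeD d g f := by
          simp only [gaugeDinv, mul_assoc]
      _ = mulOp d g * plus (Dinv d * (mulOp d f * A)) * gaugeD d g f +
          mulOp d g * (Dinv d * mulOp d a * gaugeD d g f) := by
          conv_lhs => rw [eq_plus_add_Dinv_mul_mulOp hA f, ← ha]
          noncomm_ring
      _ = _ := by rw [Dinv_mul_mulOp_mul_gaugeD hfg]; noncomm_ring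

variable {e : Derivation ℚ R R}

theorem tmap_gaugeD_swap (he : ∀ h, e (d h) = d (e h)) (hfg : f * g = 1) :
    tmap e (gaugeD d g f) = mulOp d (d (e f * g)) := by
  have h : e g * f = -(e f * g) := by
    rw [derivation_inv_eq e hfg]; linear_combination -(e f * g) * hfg
  rw [tmap_gaugeD he ((mul_comm g f).trans hfg), h, map_neg, mulOp_neg, neg_neg]

/-- With `V = g D f`, the operator `V⁻¹ ∂V` is the whole negative part of `V⁻¹ L₊ V`, and `V⁻¹ L₋ V`
has order at most `-1`. -/
theorem plus_adj_conj (he : ∀ h, e (d h) = d (e h)) (hfg : f * g = 1) {L : PDO d}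
    (hf : e f = -res (Dinv d * (mulOp d f * plus L))) :
    plus (gaugeDinv d g f * L * gaugeD d g f) =
      gaugeDinv d g f * plus L * gaugeD d g f - gaugeDinv d g f * tmap e (gaugeD d g f) := by
  have h1 : gaugeDinv d g f * tmap e (gaugeD d g f) =
      minus (gaugeDinv d g f * plus L * gaugeD d g f) := by
    rw [minus_adj_conj hfg (isDiff_plus L), ← neg_eq_iff_eq_neg.mpr hf, tmap_gaugeD_swap he hfg,
      gaugeDinv, neg_mul, map_neg, mul_neg, mulOp_neg, mulOp_mul]
    noncomm_ring
  have h2 := plus_add_minus (gaugeDinv d g f * plus L * gaugeD d g f)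
  rw [h1, minus_eq_sub, sub_sub_cancel]
  refine plus_eq_of_add (isDiff_plus _) (C := minus (gaugeDinv d g f * plus L * gaugeD d g f) +
    gaugeDinv d g f * minus L * gaugeD d g f) ((ordLE_minus _).add ?_) ?_
  · exact ((ordLE_gaugeDinv g f).mul (ordLE_minus L)).mul (ordLE_gaugeD g f)
  · rw [← add_assoc, h2]
    conv_lhs => rw [← plus_add_minus L]
    noncomm_ring

theorem tmap_gaugeDinv_swap (he : ∀ h, e (d h) = d (e h)) (hfg : f * g = 1) :
    tmap e (gaugeDinv d g f) =
      -(gaugeDinv d g f * tmap e (gaugeD d g f) * gaugeDinv d g f) := by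
  have hgf : g * f = 1 := (mul_comm g f).trans hfg
  have h := congrArg (tmap e) (gaugeDinv_mul_gaugeD (d := d) hgf)
  rw [tmap_mul he, tmap_one] at h
  calc _ = tmap e (gaugeDinv d g f) * (gaugeD d g f * gaugeDinv d g f) := by
        rw [gaugeD_mul_gaugeDinv hgf, mul_one]
    _ = _ := by rw [← mul_assoc, eq_neg_of_add_eq_zero_left h, neg_mul]

theorem adj_wilson_sato (he : ∀ h, e (d h) = d (e h)) (hfg : f * g = 1) {L W : PDO d}
    (hf : e f = -res (Dinv d * (mulOp d f * plus L))) (hW : tmap e W = -(minus L * W)) :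
    tmap e (gaugeDinv d g f * W * (D d : PDO d)) =
      -(minus (gaugeDinv d g f * L * gaugeD d g f) * (gaugeDinv d g f * W * (D d : PDO d))) := by
  have h := gaugeD_mul_gaugeDinv (d := d) ((mul_comm g f).trans hfg)
  rw [minus_eq_sub, plus_adj_conj he hfg hf, tmap_mul he, tmap_mul he, tmap_D, hW,
    minus_eq_sub, tmap_gaugeDinv_swap he hfg]
  set V := gaugeD d g f
  set U := gaugeDinv d g f
  calc _ = (-(U * tmap e V * U * W) - U * (L - plus L) * W) * (D d : PDO d) := by noncomm_ring
    _ = (-(U * tmap e V * U * W) - U * (L - plus L) * (V * U) * W) * (D d : PDO d) := by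
      rw [h, mul_one]
    _ = _ := by noncomm_ring

/-- As for `gauge_eigen`: `D⁻¹ T(h)` may be replaced by `-D⁻¹ h V`, `V = g D f`, without changing
the residue, and then `V V⁻¹` cancels. -/
theorem adj_adj_eigen (he : ∀ h, e (d h) = d (e h)) (hfg : f * g = 1) {L : PDO d}
    (hf : e f = -res (Dinv d * (mulOp d f * plus L))) {h : R}
    (hh : e h = -res (Dinv d * (mulOp d h * plus L))) :
    e (f * d (h * g)) = -res (Dinv d * (mulOp d (f * d (h * g)) *
      plus (gaugeDinv d g f * L * gaugeD d g f))) := by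
  have h1 : Dinv d * mulOp d (f * d (h * g)) = mulOp d h - Dinv d * mulOp d h * gaugeD d g f := by
    rw [Dinv_mul_mulOp_mul_gaugeD hfg, sub_sub_cancel]
  rw [← mul_assoc, h1, sub_mul, res_sub,
    res_eq_zero_of_isDiff ((isDiff_mulOp h).mul (isDiff_plus _)), zero_sub, neg_neg,
    plus_adj_conj he hfg hf]
  have h2 := gaugeD_mul_gaugeDinv (d := d) ((mul_comm g f).trans hfg)
  have h3 : Dinv d * mulOp d h * gaugeD d g f *
      (gaugeDinv d g f * plus L * gaugeD d g f - gaugeDinv d g f * tmap e (gaugeD d g f)) =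
      Dinv d * (mulOp d h * plus L) * gaugeD d g f -
        Dinv d * mulOp d h * tmap e (gaugeD d g f) := by
    calc _ = Dinv d * mulOp d h * (gaugeD d g f * gaugeDinv d g f) * plus L * gaugeD d g f -
        Dinv d * mulOp d h * (gaugeD d g f * gaugeDinv d g f) * tmap e (gaugeD d g f) := by
          noncomm_ring
      _ = _ := by rw [h2]; noncomm_ring
  rw [h3, eq_plus_add_Dinv_mul_mulOp (isDiff_plus L) h, ← neg_eq_iff_eq_neg.mpr hh, add_mul,
    res_sub, res_add, res_eq_zero_of_isDiff ((isDiff_plus _).mul (isDiff_gaugeD g f)), zero_add,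
    Dinv_mul_mulOp_mul_gaugeD hfg, res_sub, res_eq_zero_of_isDiff (isDiff_mulOp _), zero_sub,
    res_mul_mulOp, tmap_gaugeD_swap he hfg, res_mul_mulOp, res_mul_mulOp,
    derivation_gauge_apply he hfg, res_Dinv, neg_mul, map_neg]
  ring

/-- From `d S = h f` follows `g D f (g S) D⁻¹ = g S + h D⁻¹`; the two terms contribute `∂f` and
`∂S`. -/
theorem adj_eigen (he : ∀ h, e (d h) = d (e h)) (hfg : f * g = 1) {L : PDO d}
    (hf : e f = -res (Dinv d * (mulOp d f * plus L))) {h S : R} (hS : d S = h * f)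
    (hS' : e S = res (Dinv d * mulOp d f * plus L * mulOp d h * Dinv d)) :
    e (g * S) = res (plus (gaugeDinv d g f * L * gaugeD d g f) * mulOp d (g * S) * Dinv d) := by
  have h0 : OrdLE (gaugeDinv d g f * tmap e (gaugeD d g f) * mulOp d (g * S) * Dinv d) (-2) := by
    rw [tmap_gaugeD_swap he hfg]
    exact (((ordLE_gaugeDinv g f).mul (ordLE_mulOp _)).mul (ordLE_mulOp _)).mul ordLE_Dinv
  rw [plus_adj_conj he hfg hf, sub_mul, sub_mul, res_sub, res_eq_zero_of_ordLE h0, sub_zero]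
  have h1 : gaugeDinv d g f * plus L * gaugeD d g f * mulOp d (g * S) * Dinv d =
      mulOp d g * (Dinv d * (mulOp d f * plus L)) * mulOp d (g * S) +
      mulOp d g * (Dinv d * mulOp d f * plus L * mulOp d h * Dinv d) := by
    calc _ = gaugeDinv d g f * plus L * mulOp d g * (D d * mulOp d (f * (g * S))) * Dinv d := by
          rw [mulOp_mul f]; simp only [gaugeD, mul_assoc]
      _ = gaugeDinv d g f * plus L * mulOp d (g * S) * (D d * Dinv d) +
          gaugeDinv d g f * plus L * mulOp d (g * (h * f)) * Dinv d := by
          rw [show f * (g * S) = S by linear_combination S * hfg, D_mul_mulOp, hS, mulOp_mul g S,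
            mulOp_mul g (h * f)]
          noncomm_ring
      _ = _ := by
          rw [D_mul_Dinv, mul_one, show g * (h * f) = h by linear_combination h * hfg]
          simp only [gaugeDinv, mul_assoc]
  rw [h1, res_add, res_mul_mulOp, res_mulOp_mul, res_mulOp_mul, ← neg_eq_iff_eq_neg.mpr hf,
    ← hS', e.leibniz, derivation_inv_eq e hfg, smul_eq_mul, smul_eq_mul]
  ring

/-- Now `f φ_i = d (S i)` stands between two factors `D⁻¹` on the left. The minus sign in `L*(f)`
reflects `(φ D⁻¹ ψ)* = -ψ D⁻¹ φ`. -/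
theorem adj_constraint {ι : Type*} [Fintype ι] (hfg : f * g = 1) {L : PDO d}
    {φ ψ S : ι → R} (hL : minus L = ∑ i, mulOp d (φ i) * Dinv d * mulOp d (ψ i))
    (hS : ∀ i, d (S i) = φ i * f) :
    minus (gaugeDinv d g f * L * gaugeD d g f) =
      -(mulOp d g * Dinv d *
        mulOp d (f * d ((res (Dinv d * (mulOp d f * L)) - ∑ i, ψ i * S i) * g))) -
      ∑ i, mulOp d (g * S i) * Dinv d * mulOp d (f * d (ψ i * g)) := by
  set a := res (Dinv d * (mulOp d f * L)) with ha
  have hterm : ∀ i, gaugeDinv d g f * (mulOp d (φ i) * Dinv d * mulOp d (ψ i)) * gaugeD d g f =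
      mulOp d g * Dinv d * mulOp d (f * d (ψ i * S i * g)) -
        mulOp d (g * S i) * Dinv d * mulOp d (f * d (ψ i * g)) := by
    intro i
    calc _ = mulOp d g * (Dinv d * mulOp d (d (S i)) * Dinv d) * mulOp d (ψ i) * gaugeD d g f := by
          rw [hS, mul_comm (φ i), mulOp_mul]; simp only [gaugeDinv, mul_assoc]
      _ = mulOp d (g * S i) * (Dinv d * mulOp d (ψ i) * gaugeD d g f) -
          mulOp d g * (Dinv d * mulOp d (S i * ψ i) * gaugeD d g f) := by
          rw [Dinv_mulOp_Dinv, mulOp_mul, mulOp_mul]; noncomm_ring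
      _ = _ := by
          rw [Dinv_mul_mulOp_mul_gaugeD hfg, Dinv_mul_mulOp_mul_gaugeD hfg, mul_comm (ψ i) (S i),
            mulOp_mul (S i), mulOp_mul g (S i)]
          noncomm_ring
  have hsum : gaugeDinv d g f * minus L * gaugeD d g f =
      mulOp d g * Dinv d * mulOp d (f * d ((∑ i, ψ i * S i) * g)) -
        ∑ i, mulOp d (g * S i) * Dinv d * mulOp d (f * d (ψ i * g)) := by
    rw [hL, Finset.mul_sum, Finset.sum_mul, Finset.sum_congr rfl fun i _ => hterm i,
      Finset.sum_sub_distrib, Finset.sum_mul, map_sum, Finset.mul_sum, mulOp_sum, Finset.mul_sum]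
  refine minus_eq_of_add (isDiff_plus (gaugeDinv d g f * plus L * gaugeD d g f)) ?_ ?_
  · refine OrdLE.sub (((ordLE_mulOp _).mul ordLE_Dinv).mul (ordLE_mulOp _)).neg
      (OrdLE.sum fun i _ => ?_)
    exact ((ordLE_mulOp _).mul ordLE_Dinv).mul (ordLE_mulOp _)
  · have h1 := minus_adj_conj (d := d) hfg (isDiff_plus L)
    rw [res_Dinv_mul_mulOp_mul_plus, ← ha] at h1
    calc _ = gaugeDinv d g f * plus L * gaugeD d g f + gaugeDinv d g f * minus L * gaugeD d g f := by
          rw [← add_mul, ← mul_add, plus_add_minus]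
      _ = _ := by
          rw [hsum, sub_mul a, map_sub, mul_sub, mulOp_sub]
          conv_lhs => rw [← plus_add_minus (gaugeDinv d g f * plus L * gaugeD d g f), h1]
          noncomm_ring

/-- `L*(f)` is an adjoint eigenfunction. -/
theorem lax_apply_adj_eigen {ι : Type*} [Fintype ι] (he : ∀ h, e (d h) = d (e h)) {L P : PDO d}
    (hP : IsDiff P) {φ ψ S : ι → R}
    (hL : minus L = ∑ i, mulOp d (φ i) * Dinv d * mulOp d (ψ i))
    (hLax : tmap e L = P * L - L * P) (hf : e f = -res (Dinv d * (mulOp d f * P)))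
    (hψ : ∀ i, e (ψ i) = -res (Dinv d * (mulOp d (ψ i) * P))) (hS : ∀ i, d (S i) = φ i * f)
    (hS' : ∀ i, e (S i) = res (Dinv d * mulOp d f * P * mulOp d (φ i) * Dinv d)) :
    e (res (Dinv d * (mulOp d f * L)) - ∑ i, ψ i * S i) =
      -res (Dinv d * (mulOp d (res (Dinv d * (mulOp d f * L)) - ∑ i, ψ i * S i) * P)) := by
  set a := res (Dinv d * (mulOp d f * L)) with ha
  set Q := plus (Dinv d * (mulOp d f * P)) with hQ
  have hPf : Dinv d * (mulOp d f * P) = Q - Dinv d * mulOp d (e f) := by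
    rw [hf, mulOp_neg, mul_neg, sub_neg_eq_add]; exact eq_plus_add_Dinv_mul_mulOp hP f
  -- The same cancellation as for `lax_apply_eigen`, with the roles of left and right factors
  -- exchanged.
  have h1 : e a = res (Q * L) - res (Dinv d * (mulOp d f * L) * P) := by
    have : e a = res (tmap e (Dinv d * (mulOp d f * L))) := rfl
    rw [this, tmap_mul he, tmap_mul he, tmap_Dinv, tmap_mulOp, hLax, zero_mul, zero_add,
      ← res_sub]
    congr 1
    calc _ = Dinv d * (mulOp d f * P) * L - Dinv d * (mulOp d f * L) * P +
          Dinv d * mulOp d (e f) * L := by noncomm_ring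
      _ = _ := by rw [hPf]; noncomm_ring
  have h2 : res (Q * L) = ∑ i, e (S i) * ψ i := by
    rw [← plus_add_minus L, mul_add, res_add,
      res_eq_zero_of_isDiff ((isDiff_plus _).mul (isDiff_plus L)), zero_add, hL, Finset.mul_sum,
      res_sum]
    refine Finset.sum_congr rfl fun i _ => ?_
    have hQ' : Q = Dinv d * (mulOp d f * P) + Dinv d * mulOp d (e f) := by
      rw [hPf, sub_add_cancel]
    rw [← mul_assoc, ← mul_assoc, res_mul_mulOp, hS', hQ', add_mul, add_mul,
      res_add, res_eq_zero_of_ordLE (((ordLE_Dinv.mul (ordLE_mulOp _)).mul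
        (ordLE_mulOp _)).mul ordLE_Dinv), add_zero]
    simp only [mul_assoc]
  have hLf : minus (Dinv d * (mulOp d f * L)) = Dinv d * mulOp d (a - ∑ i, ψ i * S i) +
      ∑ i, mulOp d (S i) * Dinv d * mulOp d (ψ i) := by
    refine minus_eq_of_add (isDiff_plus (Dinv d * (mulOp d f * plus L))) ?_ ?_
    · exact (ordLE_Dinv.mul (ordLE_mulOp _)).add
        (OrdLE.sum fun i _ => ((ordLE_mulOp _).mul ordLE_Dinv).mul (ordLE_mulOp _))
    · have hterm : ∀ i, Dinv d * (mulOp d f * (mulOp d (φ i) * Dinv d * mulOp d (ψ i))) =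
          mulOp d (S i) * Dinv d * mulOp d (ψ i) - Dinv d * mulOp d (ψ i * S i) := by
        intro i
        calc _ = (Dinv d * mulOp d (d (S i)) * Dinv d) * mulOp d (ψ i) := by
              rw [hS, mul_comm (φ i), mulOp_mul]; simp only [mul_assoc]
          _ = _ := by rw [Dinv_mulOp_Dinv, mul_comm (ψ i), mulOp_mul]; noncomm_ring
      have hm : Dinv d * (mulOp d f * minus L) = ∑ i, mulOp d (S i) * Dinv d * mulOp d (ψ i) -
          Dinv d * mulOp d (∑ i, ψ i * S i) := by
        rw [hL, Finset.mul_sum, Finset.mul_sum, Finset.sum_congr rfl fun i _ => hterm i,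
          Finset.sum_sub_distrib, mulOp_sum, Finset.mul_sum]
      have hp := eq_plus_add_Dinv_mul_mulOp (isDiff_plus L) f
      rw [res_Dinv_mul_mulOp_mul_plus, ← ha] at hp
      calc _ = Dinv d * (mulOp d f * plus L) + Dinv d * (mulOp d f * minus L) := by
            rw [← mul_add, ← mul_add, plus_add_minus]
        _ = plus (Dinv d * (mulOp d f * plus L)) + Dinv d * mulOp d a +
            Dinv d * (mulOp d f * minus L) := by rw [← hp]
        _ = _ := by rw [hm, mulOp_sub]; noncomm_ring
  have h3 : res (Dinv d * (mulOp d f * L) * P) =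
      res (Dinv d * (mulOp d (a - ∑ i, ψ i * S i) * P)) - ∑ i, S i * e (ψ i) := by
    have hterm : ∀ i, res (mulOp d (S i) * Dinv d * mulOp d (ψ i) * P) = -(S i * e (ψ i)) := by
      intro i
      rw [mul_assoc, mul_assoc, res_mulOp_mul, hψ, mul_neg, neg_neg]
    rw [← plus_add_minus (Dinv d * (mulOp d f * L)), add_mul, res_add,
      res_eq_zero_of_isDiff ((isDiff_plus _).mul hP), zero_add, hLf, add_mul, res_add,
      mul_assoc (Dinv d), Finset.sum_mul, res_sum, Finset.sum_congr rfl fun i _ => hterm i,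
      Finset.sum_neg_distrib, ← sub_eq_add_neg]
  rw [map_sub, map_sum, h1, h2, h3]
  simp only [Derivation.leibniz, smul_eq_mul, Finset.sum_add_distrib]
  rw [Finset.sum_congr rfl fun i _ => mul_comm (ψ i) (e (S i))]
  ring

end AdjointDarboux

end PDO

namespace KP

open PDO

variable {R : Type*} [CommRing R] [Algebra ℚ R] {δ : ℕ+ → Derivation ℚ R R}

/-! ### Fractional powers of the Lax operator and the Lax equation. -/

theorem coe_laxPow (W : (PDO (δ 1))ˣ) (n : ℕ+) :
    laxPow δ W n = W * (D (δ 1) : PDO (δ 1)) ^ (n : ℕ) * (W⁻¹ : (PDO (δ 1))ˣ) := by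
  simp [laxPow]

theorem laxPow_commute (W : (PDO (δ 1))ˣ) (n m : ℕ+) :
    laxPow δ W n * laxPow δ W m = laxPow δ W m * laxPow δ W n := by
  unfold laxPow
  rw [← Units.val_mul, ← Units.val_mul, ← conj_pow, ← conj_pow, ← pow_add, ← pow_add, add_comm]

/-- The right factor `D⁻¹` or `D` of a transformed dressing operator commutes with `D` and drops
out, so one `U` conjugates all the powers. -/
theorem laxPow_conj {W U V : (PDO (δ 1))ˣ} (hV : V * D (δ 1) = D (δ 1) * V) (n : ℕ+) :
    laxPow δ (U * W * V) n =
      U * laxPow δ W n * (U⁻¹ : (PDO (δ 1))ˣ) := by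
  have hc : V * D (δ 1) ^ (n : ℕ) * V⁻¹ = D (δ 1) ^ (n : ℕ) := by
    rw [(show Commute V (D (δ 1)) from hV).pow_right, mul_inv_cancel_right]
  unfold laxPow
  rw [← Units.val_mul, ← Units.val_mul]
  congr 1
  calc _ = U * W * (V * D (δ 1) ^ (n : ℕ) * V⁻¹) * W⁻¹ * U⁻¹ := by
        simp only [mul_inv_rev, mul_assoc]
    _ = _ := by rw [hc]; simp only [mul_assoc]

theorem tmap_inv {e : Derivation ℚ R R} (he : ∀ f, e (δ 1 f) = δ 1 (e f)) (W : (PDO (δ 1))ˣ) :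
    tmap e ((W⁻¹ : (PDO (δ 1))ˣ) : PDO (δ 1)) =
      -((W⁻¹ : (PDO (δ 1))ˣ) * tmap e (W : PDO (δ 1)) * (W⁻¹ : (PDO (δ 1))ˣ)) := by
  have h := congrArg (tmap e) W.inv_mul
  rw [tmap_mul he, tmap_one] at h
  have h' := congrArg (· * ((W⁻¹ : (PDO (δ 1))ˣ) : PDO (δ 1))) (eq_neg_of_add_eq_zero_left h)
  simpa only [mul_assoc, W.mul_inv, mul_one, neg_mul] using h'

theorem tmap_D_pow {e : Derivation ℚ R R} (he : ∀ f, e (δ 1 f) = δ 1 (e f)) (n : ℕ) :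
    tmap e ((D (δ 1) : PDO (δ 1)) ^ n) = 0 := by
  induction n with
  | zero => rw [pow_zero, tmap_one]
  | succ n ih => rw [pow_succ, tmap_mul he, ih, tmap_D, zero_mul, mul_zero, add_zero]

/-- The Lax equation `∂_n L = [(L^{n/r})₊, L]`. -/
theorem lax_equation {n : ℕ+} (he : ∀ f, δ n (δ 1 f) = δ 1 (δ n f)) {W : (PDO (δ 1))ˣ}
    (hW : tmap (δ n) (W : PDO (δ 1)) = -(minus (laxPow δ W n) * W)) (r : ℕ+) :
    tmap (δ n) (laxPow δ W r) =
      plus (laxPow δ W n) * laxPow δ W r - laxPow δ W r * plus (laxPow δ W n) := by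
  -- As `L^{n/r}` commutes with `L`, the commutator with `(L^{n/r})₊` is minus the one with
  -- `(L^{n/r})₋`.
  have hc := laxPow_commute W n r
  set N := laxPow δ W n
  rw [eq_sub_of_add_eq (plus_add_minus N), sub_mul, mul_sub, hc, sub_sub_sub_cancel_left,
    coe_laxPow, tmap_mul he, tmap_mul he, tmap_D_pow he, tmap_inv he, hW]
  have h : (W : PDO (δ 1)) * (W⁻¹ : (PDO (δ 1))ˣ) = 1 := W.mul_inv
  generalize ((W⁻¹ : (PDO (δ 1))ˣ) : PDO (δ 1)) = V at *
  generalize (D (δ 1) : PDO (δ 1)) ^ (r : ℕ) = Dr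
  calc _ = -(minus N * (W * Dr * V)) + W * Dr * V * minus N * (W * V) := by noncomm_ring
    _ = _ := by rw [h]; noncomm_ring

/-- In `V = 1 - (W - 1) V` the factor `W - 1` has negative order. A positive bound on the order of
`V` can therefore be lowered by one until it reaches zero. -/
theorem ordLE_inv {W : (PDO (δ 1))ˣ} (h0 : OrdLE (W : PDO (δ 1)) 0)
    (h1 : (W : PDO (δ 1)).coeff 0 = 1) : OrdLE ((W⁻¹ : (PDO (δ 1))ˣ) : PDO (δ 1)) 0 := by
  set V := ((W⁻¹ : (PDO (δ 1))ˣ) : PDO (δ 1)) with hV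
  have hw := ordLE_sub_one h0 h1
  have hVe : V = 1 - ((W : PDO (δ 1)) - 1) * V := by
    rw [sub_mul, one_mul, hV, W.mul_inv, sub_sub_cancel]
  have hone : OrdLE (1 : PDO (δ 1)) 0 := ordLE_monomial 0 1
  have key : ∀ k : ℕ, OrdLE V k → OrdLE V 0 := by
    intro k
    induction k with
    | zero => exact id
    | succ k ih =>
      intro hk
      refine ih ?_
      rw [hVe]
      exact (hone.mono (by omega)).sub ((hw.mul hk).mono (by push_cast; omega))
  obtain ⟨N, hN⟩ := V.bdd
  exact key N.toNat (OrdLE.mono hN (Int.self_le_toNat N))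

/-- `W D W⁻¹ = D - (∂ₓW) W⁻¹`, and `∂ₓW` has negative order because the leading coefficient of `W`
is constant. -/
theorem plus_laxPow_one {W : (PDO (δ 1))ˣ} (h0 : OrdLE (W : PDO (δ 1)) 0)
    (h1 : (W : PDO (δ 1)).coeff 0 = 1) : plus (laxPow δ W 1) = D (δ 1) := by
  refine plus_eq_of_add isDiff_D
    (C := -(tmap (δ 1) (W : PDO (δ 1)) * (W⁻¹ : (PDO (δ 1))ˣ))) ?_ ?_
  · have hd : OrdLE (tmap (δ 1) (W : PDO (δ 1))) (-1) := by
      intro n hn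
      rw [coeff_tmap]
      rcases eq_or_ne n 0 with rfl | hn0
      · rw [h1, Derivation.map_one_eq_zero]
      · rw [h0 n (by omega), map_zero]
    exact (hd.mul (ordLE_inv h0 h1)).neg
  · have h := D_mul (W : PDO (δ 1))
    rw [coe_laxPow, PNat.one_coe, pow_one, ← sub_eq_of_eq_add h, sub_mul,
      mul_assoc _ (W : PDO (δ 1)), W.mul_inv, mul_one, sub_eq_add_neg]

/-- The case `n = 1` of the potential equations, where `(L^{1/r})₊ = D`; every integration by parts
relies on it. -/
theorem IsSEP.derivation_one {W : (PDO (δ 1))ˣ} (h0 : OrdLE (W : PDO (δ 1)) 0)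
    (h1 : (W : PDO (δ 1)).coeff 0 = 1) {Φ Ψ S : R} (hS : IsSEP δ W Φ Ψ S) : δ 1 S = Φ * Ψ := by
  rw [hS 1, plus_laxPow_one h0 h1]
  have h : Dinv (δ 1) * mulOp (δ 1) Ψ * D (δ 1) * mulOp (δ 1) Φ * Dinv (δ 1) =
      Dinv (δ 1) * mulOp (δ 1) (Ψ * Φ) * (D (δ 1) * Dinv (δ 1)) +
      Dinv (δ 1) * mulOp (δ 1) Ψ * (mulOp (δ 1) (δ 1 Φ) * Dinv (δ 1)) := by
    rw [mul_assoc _ _ (mulOp (δ 1) Φ), D_mul_mulOp, mulOp_mul]; noncomm_ring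
  rw [h, res_add, res_eq_zero_of_ordLE ((ordLE_Dinv.mul (ordLE_mulOp _)).mul
    ((ordLE_mulOp _).mul ordLE_Dinv)), add_zero, D_mul_Dinv, mul_one, res_mul_mulOp, res_Dinv,
    one_mul, mul_comm]

/-! ### Eigenfunction equations as residue identities. -/

theorem IsEigenfunction.eq_res {W : (PDO (δ 1))ˣ} {Φ : R} (h : IsEigenfunction δ W Φ) (n : ℕ+) :
    δ n Φ = res (plus (laxPow δ W n) * mulOp (δ 1) Φ * Dinv (δ 1)) := by
  rw [h n, res_plus_mul_mulOp_mul_Dinv, plusApply_eq]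

theorem isEigenfunction_of_eq_res {W : (PDO (δ 1))ˣ} {Φ : R}
    (h : ∀ n, δ n Φ = res (plus (laxPow δ W n) * mulOp (δ 1) Φ * Dinv (δ 1))) :
    IsEigenfunction δ W Φ := fun n => by
  rw [h n, res_plus_mul_mulOp_mul_Dinv, plusApply_eq]

theorem IsAdjEigenfunction.eq_res {W : (PDO (δ 1))ˣ} {Ψ : R} (h : IsAdjEigenfunction δ W Ψ)
    (n : ℕ+) : δ n Ψ = -res (Dinv (δ 1) * (mulOp (δ 1) Ψ * plus (laxPow δ W n))) := by
  rw [h n, res_Dinv_mul_mulOp_mul_plus, adjPlusApply_eq]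

theorem isAdjEigenfunction_of_eq_res {W : (PDO (δ 1))ˣ} {Ψ : R}
    (h : ∀ n, δ n Ψ = -res (Dinv (δ 1) * (mulOp (δ 1) Ψ * plus (laxPow δ W n)))) :
    IsAdjEigenfunction δ W Ψ := fun n => by
  rw [h n, res_Dinv_mul_mulOp_mul_plus, adjPlusApply_eq]

theorem IsEigenfunction.neg {W : (PDO (δ 1))ˣ} {Φ : R} (h : IsEigenfunction δ W Φ) :
    IsEigenfunction δ W (-Φ) := fun n => by
  rw [map_neg, h n, plusApply_eq, plusApply_eq, mulOp_neg, mul_neg, neg_mul, res_neg]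

theorem IsAdjEigenfunction.neg {W : (PDO (δ 1))ˣ} {Ψ : R} (h : IsAdjEigenfunction δ W Ψ) :
    IsAdjEigenfunction δ W (-Ψ) := fun n => by
  rw [map_neg, h n, adjPlusApply_eq, adjPlusApply_eq, mulOp_neg, neg_mul, mul_neg, res_neg]

/-! ### Invariance of the constrained hierarchy under both kinds of step. -/

variable {m : ℕ}

/-- A solution of the constrained KP hierarchy, where the tau-function is tied to the dressing
operator only through the first coefficient `-∂ₓ ln τ`. These properties are inherited by
Darboux-Bäcklund transforms. -/
structure IsDressedCKP (r : ℕ+) (X : Site δ m) : Prop where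
  isUnit_tau : IsUnit X.τ
  ordLE : OrdLE (X.W : PDO (δ 1)) 0
  coeff_zero : (X.W : PDO (δ 1)).coeff 0 = 1
  coeff_neg_one : (X.W : PDO (δ 1)).coeff (-1) = -(δ 1 X.τ * X.τ⁻¹ʳ)
  wilson_sato : ∀ n : ℕ+,
    tmap (δ n) (X.W : PDO (δ 1)) = -(minus (laxPow δ X.W n) * (X.W : PDO (δ 1)))
  lax_minus : minus (X.lax r) = ∑ i, mulOp (δ 1) (X.Φ i) *
    Dinv (δ 1) * mulOp (δ 1) (X.Ψ i)
  eigen : ∀ i, IsEigenfunction δ X.W (X.Φ i)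
  adj_eigen : ∀ i, IsAdjEigenfunction δ X.W (X.Ψ i)

theorem schurNeg_zero : schurNeg δ 0 = 1 := by
  simp [schurNeg]

theorem schurNeg_one : schurNeg δ 1 = -((δ 1 : Derivation ℚ R R) : R →ₗ[ℚ] R) := by
  simp [schurNeg, Finset.sum_range_succ, PowerSeries.coeff_one]

/-- Of the Sato formula only `p₀(-[∂]) = 1` and `p₁(-[∂]) = -∂₁`, and the absence of positive
powers, are retained. -/
theorem IsCKP.isDressedCKP {r : ℕ+} {X : Site δ m} (h : IsCKP r X) : IsDressedCKP r X where
  isUnit_tau := h.isUnit_tau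
  ordLE := by
    rw [h.dressing_eq]
    exact fun z hz => if_neg (not_le.mpr hz)
  coeff_zero := by
    have : (dressing δ X.τ).coeff 0 = schurNeg δ 0 X.τ * X.τ⁻¹ʳ := by
      simp [dressing]
    rw [h.dressing_eq, this, schurNeg_zero]
    exact Ring.mul_inverse_cancel _ h.isUnit_tau
  coeff_neg_one := by
    have : (dressing δ X.τ).coeff (-1) = schurNeg δ 1 X.τ * X.τ⁻¹ʳ := by
      simp [dressing]
    rw [h.dressing_eq, this, schurNeg_one, ← neg_mul]
    rfl
  wilson_sato n := by
    ext z
    exact h.wilson_sato n z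
  lax_minus := h.lax_minus
  eigen := h.eigen
  adj_eigen := h.adj_eigen

/-- Logarithmic derivatives are additive. -/
theorem logDeriv_mul (e : Derivation ℚ R R) {f t : R} (hf : IsUnit f) (ht : IsUnit t) :
    e (f * t) * (f * t)⁻¹ʳ = e f * f⁻¹ʳ + e t * t⁻¹ʳ := by
  rw [e.leibniz, Ring.mul_inverse_rev, smul_eq_mul, smul_eq_mul]
  linear_combination (e f * f⁻¹ʳ) * Ring.mul_inverse_cancel t ht +
    (e t * t⁻¹ʳ) * Ring.mul_inverse_cancel f hf

theorem IsDB.isDressedCKP (hδ : ∀ (i j : ℕ+) (f : R), δ i (δ j f) = δ j (δ i f)) {r : ℕ+}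
    {a : Fin m} {S : Fin m → R} {X Y : Site δ m} (hX : IsDressedCKP r X) (h : IsDB r a S X Y) :
    IsDressedCKP r Y := by
  have hfg : X.Φ a * (X.Φ a)⁻¹ʳ = 1 := Ring.mul_inverse_cancel _ h.isUnit
  have hWu : Y.W = gaugeUnit (δ 1) hfg * X.W * (D (δ 1))⁻¹ := Units.ext h.dressing_eq
  have hlax : ∀ n, laxPow δ Y.W n = gaugeD (δ 1) (X.Φ a) (X.Φ a)⁻¹ʳ * laxPow δ X.W n *
      gaugeDinv (δ 1) (X.Φ a) (X.Φ a)⁻¹ʳ := fun n => by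
    rw [hWu, laxPow_conj (by group)]; rfl
  have hf := fun n => (hX.eigen a).eq_res n
  have hS : ∀ i, δ 1 (S i) = X.Φ a * X.Ψ i := fun i =>
    (h.sep i).derivation_one hX.ordLE hX.coeff_zero
  -- Read off from `(D - ∂ₓ ln Φ_a) W D⁻¹`. At `n = -1` it subtracts `∂ₓ ln Φ_a`, which matches `τ ↦
  -- Φ_a τ`.
  have hcoeff : ∀ n, (Y.W : PDO (δ 1)).coeff n = (X.W : PDO (δ 1)).coeff n +
      δ 1 ((X.W : PDO (δ 1)).coeff (n + 1)) -
        δ 1 (X.Φ a) * (X.Φ a)⁻¹ʳ * (X.W : PDO (δ 1)).coeff (n + 1) := fun n => by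
    have e1 : (Y.W : PDO (δ 1)) =
        gaugeD (δ 1) (X.Φ a) (X.Φ a)⁻¹ʳ * X.W * Dinv (δ 1) := h.dressing_eq
    rw [e1, coeff_mul_Dinv, gaugeD_eq hfg, add_mul, coeff_add, D_mul, coeff_add, coeff_mul_D,
      coeff_tmap, coeff_mulOp_mul, add_sub_cancel_right, derivation_inv_eq _ hfg]
    linear_combination (-(δ 1 (X.Φ a)) * (X.Φ a)⁻¹ʳ * (X.W : PDO (δ 1)).coeff (n + 1)) * hfg
  refine ⟨?_, ?_, ?_, ?_, fun n => ?_, ?_, fun i => ?_, fun i => ?_⟩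
  · rw [h.tau_eq]; exact h.isUnit.mul hX.isUnit_tau
  · intro n hn
    rw [hcoeff, hX.ordLE n hn, hX.ordLE (n + 1) (by omega), map_zero, mul_zero, add_zero, sub_zero]
  · rw [hcoeff, hX.coeff_zero, hX.ordLE (0 + 1) (by norm_num), map_zero, mul_zero, add_zero,
      sub_zero]
  · rw [hcoeff, h.tau_eq, logDeriv_mul _ h.isUnit hX.isUnit_tau, neg_add_cancel, hX.coeff_zero,
      hX.coeff_neg_one, Derivation.map_one_eq_zero]
    ring
  · rw [hlax, h.dressing_eq]
    exact gauge_wilson_sato (hδ n 1) hfg (hf n) (hX.wilson_sato n)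
  -- The summand of index `a` vanishes because `T(Φ_a) = 0`; the pair `T(L(Φ_a))`, `1 / Φ_a` takes
  -- its place.
  · rw [show Y.lax r = _ * X.lax r * _ from hlax r, gauge_constraint hfg hX.lax_minus hS,
      ← Finset.sum_erase Finset.univ (a := a)
        (f := fun i => mulOp (δ 1) (X.Φ a * δ 1 _) * _ * _)
        (by rw [hfg, Derivation.map_one_eq_zero,
        mul_zero, mulOp_zero, zero_mul, zero_mul]),
      ← Finset.add_sum_erase Finset.univ (fun i => mulOp (δ 1) (Y.Φ i) * _ * _)
        (Finset.mem_univ a), h.phi_self, h.psi_self, plusApply_eq, sub_eq_add_neg,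
      ← Finset.sum_neg_distrib]
    refine congrArg _ (Finset.sum_congr rfl fun i hi => ?_)
    have hi' := Finset.ne_of_mem_erase hi
    rw [h.phi_other i hi', h.psi_other i hi', mulOp_neg, mul_neg]
  · refine isEigenfunction_of_eq_res fun n => ?_
    rw [hlax]
    by_cases hi : i = a
    · rw [hi, h.phi_self, plusApply_eq]
      exact gauge_eigen (hδ n 1) hfg (hf n) (lax_apply_eigen (hδ n 1) (isDiff_plus _)
        hX.lax_minus (lax_equation (hδ n 1) (hX.wilson_sato n) r) (hf n)
        (fun i => (hX.eigen i).eq_res n) hS (fun i => h.sep i n))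
    · rw [h.phi_other i hi]
      exact gauge_eigen (hδ n 1) hfg (hf n) ((hX.eigen i).eq_res n)
  · by_cases hi : i = a
    · refine isAdjEigenfunction_of_eq_res fun n => ?_
      -- The new `Ψ_a = 1 / Φ_a` is the case of the zero adjoint eigenfunction with constant
      -- potential `1`.
      have := gauge_adj_eigen (hδ n 1) hfg (hf n) (h := 0) (S := 1)
        (by rw [Derivation.map_one_eq_zero, mul_zero])
        (by rw [Derivation.map_one_eq_zero, mulOp_zero]; simp only [mul_zero, zero_mul]; rfl)
      rwa [mul_one, ← hlax, ← h.psi_self, ← hi] at this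
    · rw [h.psi_other i hi]
      refine IsAdjEigenfunction.neg (isAdjEigenfunction_of_eq_res fun n => ?_)
      rw [hlax]
      exact gauge_adj_eigen (hδ n 1) hfg (hf n) (hS i) (h.sep i n)

theorem IsAdjDB.isDressedCKP (hδ : ∀ (i j : ℕ+) (f : R), δ i (δ j f) = δ j (δ i f)) {r : ℕ+}
    {b : Fin m} {S : Fin m → R} {X Y : Site δ m} (hX : IsDressedCKP r X)
    (h : IsAdjDB r b S X Y) : IsDressedCKP r Y := by
  have hfg : X.Ψ b * (X.Ψ b)⁻¹ʳ = 1 := Ring.mul_inverse_cancel _ h.isUnit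
  have hgf : (X.Ψ b)⁻¹ʳ * X.Ψ b = 1 := (mul_comm _ _).trans hfg
  have hWu : Y.W = (gaugeUnit (δ 1) hgf)⁻¹ * X.W * D (δ 1) := Units.ext h.dressing_eq
  have hlax : ∀ n, laxPow δ Y.W n = gaugeDinv (δ 1) (X.Ψ b)⁻¹ʳ (X.Ψ b) * laxPow δ X.W n *
      gaugeD (δ 1) (X.Ψ b)⁻¹ʳ (X.Ψ b) := fun n => by
    rw [hWu, laxPow_conj rfl, inv_inv]; rfl
  have hf := fun n => (hX.adj_eigen b).eq_res n
  have hS : ∀ i, δ 1 (S i) = X.Φ i * X.Ψ b := fun i =>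
    (h.sep i).derivation_one hX.ordLE hX.coeff_zero
  have hW : (Y.W : PDO (δ 1)) =
      gaugeDinv (δ 1) (X.Ψ b)⁻¹ʳ (X.Ψ b) * X.W * (D (δ 1) : PDO (δ 1)) := h.dressing_eq
  have hord : OrdLE (Y.W : PDO (δ 1)) 0 := by
    rw [hW]
    exact (((ordLE_gaugeDinv _ _).mul hX.ordLE).mul ordLE_D).mono (by norm_num)
  -- To avoid expanding `D⁻¹`, coefficients are compared after multiplying the new dressing operator
  -- by `Ψ_b⁻¹ D Ψ_b`. Then `n = 1` gives the leading coefficient and `n = 0` the next one.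
  have hcoeff : ∀ n, (Y.W : PDO (δ 1)).coeff (n - 1) + δ 1 ((Y.W : PDO (δ 1)).coeff n) +
      δ 1 (X.Ψ b) * (X.Ψ b)⁻¹ʳ * (Y.W : PDO (δ 1)).coeff n =
        (X.W : PDO (δ 1)).coeff (n - 1) := fun n => by
    have e1 : gaugeD (δ 1) (X.Ψ b)⁻¹ʳ (X.Ψ b) * (Y.W : PDO (δ 1)) = X.W * (D (δ 1) : PDO (δ 1)) := by
      rw [hW, ← mul_assoc, ← mul_assoc, gaugeD_mul_gaugeDinv hgf, one_mul]
    have e2 := congrArg (fun A => A.coeff n) e1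
    simp only [gaugeD_eq hgf, add_mul, coeff_add, D_mul, coeff_mul_D, coeff_tmap,
      coeff_mulOp_mul] at e2
    rw [← e2, mul_comm (δ 1 (X.Ψ b))]
  have hzero : (Y.W : PDO (δ 1)).coeff 0 = 1 := by
    have := hcoeff 1
    rwa [hord 1 (by norm_num), map_zero, mul_zero, add_zero, add_zero, sub_self,
      hX.coeff_zero] at this
  refine ⟨?_, hord, hzero, ?_, fun n => ?_, ?_, fun i => ?_, fun i => ?_⟩
  · rw [h.tau_eq]; exact h.isUnit.mul hX.isUnit_tau
  · have := hcoeff 0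
    rw [hzero, Derivation.map_one_eq_zero, zero_sub, hX.coeff_neg_one] at this
    rw [h.tau_eq, logDeriv_mul _ h.isUnit hX.isUnit_tau]
    linear_combination this
  · rw [hlax, h.dressing_eq]
    exact adj_wilson_sato (hδ n 1) hfg (hf n) (hX.wilson_sato n)
  · rw [show Y.lax r = _ * X.lax r * _ from hlax r, adj_constraint hfg hX.lax_minus hS,
      ← Finset.sum_erase Finset.univ (a := b)
        (f := fun i => _ * _ * mulOp (δ 1) (X.Ψ b * δ 1 _))
        (by rw [hfg, Derivation.map_one_eq_zero,
        mul_zero, mulOp_zero, mul_zero]),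
      ← Finset.add_sum_erase Finset.univ (fun i => mulOp (δ 1) (Y.Φ i) * _ * _)
        (Finset.mem_univ b), h.phi_self, h.psi_self, adjPlusApply_eq, sub_eq_add_neg,
      ← Finset.sum_neg_distrib, mulOp_neg, neg_mul, neg_mul]
    refine congrArg _ (Finset.sum_congr rfl fun i hi => ?_)
    have hi' := Finset.ne_of_mem_erase hi
    rw [h.phi_other i hi', h.psi_other i hi', mulOp_neg, neg_mul, neg_mul]
  · by_cases hi : i = b
    · rw [hi, h.phi_self]
      refine IsEigenfunction.neg (isEigenfunction_of_eq_res fun n => ?_)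
      -- Again the zero eigenfunction with constant potential `1`, up to sign.
      have := adj_eigen (hδ n 1) hfg (hf n) (h := 0) (S := 1)
        (by rw [Derivation.map_one_eq_zero, zero_mul])
        (by rw [Derivation.map_one_eq_zero, mulOp_zero]; simp only [mul_zero, zero_mul]; rfl)
      rwa [mul_one, ← hlax] at this
    · rw [h.phi_other i hi]
      refine IsEigenfunction.neg (isEigenfunction_of_eq_res fun n => ?_)
      rw [hlax]
      exact adj_eigen (hδ n 1) hfg (hf n) (hS i) (h.sep i n)
  · refine isAdjEigenfunction_of_eq_res fun n => ?_
    rw [hlax]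
    by_cases hi : i = b
    · rw [hi, h.psi_self, adjPlusApply_eq]
      exact adj_adj_eigen (hδ n 1) hfg (hf n) (lax_apply_adj_eigen (hδ n 1) (isDiff_plus _)
        hX.lax_minus (lax_equation (hδ n 1) (hX.wilson_sato n) r) (hf n)
        (fun i => (hX.adj_eigen i).eq_res n) hS (fun i => h.sep i n))
    · rw [h.psi_other i hi]
      exact adj_adj_eigen (hδ n 1) hfg (hf n) ((hX.adj_eigen i).eq_res n)

/-- A site is reached by DB steps along the row `k = 0` followed by adjoint steps; downward closure
keeps this path in `Ω`. -/
theorem IsBinaryDBOrbit.isDressedCKP (hδ : ∀ (i j : ℕ+) (f : R), δ i (δ j f) = δ j (δ i f))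
    {r : ℕ+} {a b : Fin m} {Ω : Set (ℕ × ℕ)} (hΩ : IsLowerSet Ω) {X : ℕ → ℕ → Site δ m}
    {S : ℕ → ℕ → Fin m → Fin m → R} (hX : IsBinaryDBOrbit r a b Ω X S) (n k : ℕ)
    (hnk : (n, k) ∈ Ω) : IsDressedCKP r (X n k) := by
  induction k with
  | zero =>
    induction n with
    | zero => exact hX.initial.isDressedCKP
    | succ n ih =>
      exact (hX.step n 0 hnk).isDressedCKP hδ (ih (hΩ (Prod.mk_le_mk.mpr ⟨by omega, le_rfl⟩) hnk))
  | succ k ih =>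
    exact (hX.adj_step n k hnk).isDressedCKP hδ
      (ih (hΩ (Prod.mk_le_mk.mpr ⟨le_rfl, by omega⟩) hnk))

/-! ### The residue of `L` and the tau-function. -/

theorem IsDressedCKP.res_lax {r : ℕ+} {X : Site δ m} (h : IsDressedCKP r X) :
    res (X.lax r) = ∑ i, X.Φ i * X.Ψ i := by
  rw [← res_minus, h.lax_minus, res_sum]
  refine Finset.sum_congr rfl fun i _ => ?_
  rw [res_mul_mulOp, res_mulOp_mul, res_Dinv, mul_one]

theorem ddlog_comm (hδ : ∀ (i j : ℕ+) (f : R), δ i (δ j f) = δ j (δ i f)) (r : ℕ+) {f : R}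
    (hf : IsUnit f) : ddlog δ r f = δ r (δ 1 f * f⁻¹ʳ) := by
  have hfg := Ring.mul_inverse_cancel f hf
  rw [ddlog, Derivation.leibniz, Derivation.leibniz, derivation_inv_eq (δ 1) hfg,
    derivation_inv_eq (δ r) hfg, hδ 1 r]
  simp only [smul_eq_mul]
  ring

/-- Compare coefficients of `D⁻¹` in `∂_r W = -L₋ W`: as `L₋ (W - 1)` has order at most `-2`, the
right side contributes `-Res L`, the left side `-∂_r ∂ₓ ln τ`. -/
theorem IsDressedCKP.ddlog_tau (hδ : ∀ (i j : ℕ+) (f : R), δ i (δ j f) = δ j (δ i f)) {r : ℕ+}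
    {X : Site δ m} (h : IsDressedCKP r X) : ddlog δ r X.τ = res (X.lax r) := by
  have h1 := congrArg (fun A : PDO (δ 1) => A.coeff (-1)) (h.wilson_sato r)
  simp only [coeff_tmap, h.coeff_neg_one, coeff_neg, map_neg, neg_inj] at h1
  rw [ddlog_comm hδ r h.isUnit_tau, h1]
  have hw := ordLE_sub_one h.ordLE h.coeff_zero
  have h2 : minus (laxPow δ X.W r) * (X.W : PDO (δ 1)) =
      minus (laxPow δ X.W r) * ((X.W : PDO (δ 1)) - 1) + minus (laxPow δ X.W r) := by
    rw [mul_sub, mul_one, sub_add_cancel]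
  rw [h2, coeff_add, ((ordLE_minus _).mul hw) (-1) (by norm_num), zero_add]
  exact res_minus _

end KP

namespace KP

variable {R : Type*} [CommRing R] [Algebra ℚ R] {δ : ℕ+ → Derivation ℚ R R}

/-! ### Algebra of the three forms of the Toda equation. -/

theorem ddlog_mul (r : ℕ+) {f t : R} (hf : IsUnit f) (ht : IsUnit t) :
    ddlog δ r (f * t) = ddlog δ r f + ddlog δ r t := by
  rw [ddlog, logDeriv_mul _ hf ht, map_add]; rfl

theorem inverse_inverse {M : Type*} [MonoidWithZero M] {f : M} (hf : IsUnit f) : f⁻¹ʳ⁻¹ʳ = f := by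
  obtain ⟨u, rfl⟩ := hf
  rw [Ring.inverse_unit, Ring.inverse_unit, inv_inv]

theorem ratio_mul_inverse_ratio {M : Type*} [CommMonoidWithZero M] (s t : M) {u : M} (hu : IsUnit u) :
    s * t⁻¹ʳ * (t * u⁻¹ʳ)⁻¹ʳ = s * u * (t ^ 2)⁻¹ʳ := by
  rw [Ring.mul_inverse_rev, inverse_inverse hu, sq, Ring.mul_inverse_rev]
  ac_rfl

theorem todaTau_iff_todaBilinear (r : ℕ+) (σ : ℕ → ℕ → R) (n k : ℕ) (hσ : IsUnit (σ n k)) :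
    TodaTau δ r σ n k ↔ TodaBilinear δ r σ n k := by
  unfold TodaTau TodaBilinear
  generalize σ (n + 1) k * σ (n - 1) k - σ n (k + 1) * σ n (k - 1) = B
  have h1 := Ring.mul_inverse_cancel _ hσ
  have h2 : ddlog δ r (σ n k) = (σ n k * δ 1 (δ r (σ n k)) - δ 1 (σ n k) * δ r (σ n k)) *
      ((σ n k) ^ 2)⁻¹ʳ := by
    rw [ddlog, Derivation.leibniz, PDO.derivation_inv_eq _ h1, sq, Ring.mul_inverse_rev,
      smul_eq_mul, smul_eq_mul]
    linear_combination -(δ 1 (δ r (σ n k)) * (σ n k)⁻¹ʳ) * h1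
  have h3 := Ring.inverse_mul_cancel _ (hσ.pow 2)
  rw [h2]
  refine ⟨fun h => ?_, fun h => by rw [h]⟩
  have := congrArg (· * (σ n k) ^ 2) h
  simpa only [mul_assoc, h3, mul_one] using this

/-- The ratio relations are assumed only at the sites involved, so that the lemma serves terminating
orbits as well as full lattices. -/
theorem todaTau_iff_ratio (r : ℕ+) {σ Φ Ψ : ℕ → ℕ → R} {n k : ℕ} (hn : IsUnit (σ n (k + 1)))
    (hk : IsUnit (σ (n + 1) k))
    (hΦ : Φ (n + 1) (k + 1) = σ (n + 2) (k + 1) * (σ (n + 1) (k + 1))⁻¹ʳ)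
    (hΦ' : Φ n (k + 1) = σ (n + 1) (k + 1) * (σ n (k + 1))⁻¹ʳ)
    (hΨ : Ψ (n + 1) (k + 1) = σ (n + 1) (k + 2) * (σ (n + 1) (k + 1))⁻¹ʳ)
    (hΨ' : Ψ (n + 1) k = σ (n + 1) (k + 1) * (σ (n + 1) k)⁻¹ʳ) :
    TodaTau δ r σ (n + 1) (k + 1) ↔ ddlog δ r (σ (n + 1) (k + 1)) =
      Φ (n + 1) (k + 1) * (Φ n (k + 1))⁻¹ʳ - Ψ (n + 1) (k + 1) * (Ψ (n + 1) k)⁻¹ʳ := by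
  rw [hΦ, hΦ', hΨ, hΨ', ratio_mul_inverse_ratio _ _ hn, ratio_mul_inverse_ratio _ _ hk, ← sub_mul]
  rfl

/-- Regrouping exhibits the right side as a difference, between the sites `n + 2` and `n + 1`, of
the expression that equals `∂ₓ ∂_r ln τ`. Shifted indices avoid subtraction in `ℕ`. -/
theorem todaPhi_iff (r : ℕ+) (Φ Ψ : ℕ → ℕ → R) (n k : ℕ) :
    TodaPhi δ r Φ Ψ (n + 1) (k + 1) ↔ ddlog δ r (Φ (n + 1) (k + 1)) =
      (Φ (n + 2) (k + 1) * (Φ (n + 1) (k + 1))⁻¹ʳ - Ψ (n + 2) (k + 1) * (Ψ (n + 2) k)⁻¹ʳ) -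
      (Φ (n + 1) (k + 1) * (Φ n (k + 1))⁻¹ʳ - Ψ (n + 1) (k + 1) * (Ψ (n + 1) k)⁻¹ʳ) := by
  simp only [TodaPhi, Nat.add_sub_cancel]
  rw [sub_sub_sub_comm]

theorem todaPsi_iff (r : ℕ+) (Φ Ψ : ℕ → ℕ → R) (n k : ℕ) :
    TodaPsi δ r Φ Ψ (n + 1) (k + 1) ↔ ddlog δ r (Ψ (n + 1) (k + 1)) =
      (Φ (n + 1) (k + 2) * (Φ n (k + 2))⁻¹ʳ - Ψ (n + 1) (k + 2) * (Ψ (n + 1) (k + 1))⁻¹ʳ) -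
      (Φ (n + 1) (k + 1) * (Φ n (k + 1))⁻¹ʳ - Ψ (n + 1) (k + 1) * (Ψ (n + 1) k)⁻¹ʳ) := by
  simp only [TodaPsi, Nat.add_sub_cancel]
  rw [sub_sub_sub_comm, neg_add_eq_sub]

theorem ddlog_ratio (r : ℕ+) {s t : R} (hs : IsUnit s) (ht : IsUnit t) :
    ddlog δ r (s * t⁻¹ʳ) = ddlog δ r s - ddlog δ r t := by
  have h := ddlog_mul (δ := δ) r (hs.mul ht.ringInverse) ht
  rw [mul_assoc, Ring.inverse_mul_cancel _ ht, mul_one] at h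
  rw [h, add_sub_cancel_right]

/-- The Toda equation for a lattice of invertible functions is equivalent to its validity at one
corner together with the coupled equations for the ratios. -/
theorem todaTau_iff_coupled (r : ℕ+) {σ : ℕ → ℕ → R} (hσ : ∀ n k, IsUnit (σ n k)) :
    (∀ n k, 1 ≤ n → 1 ≤ k → TodaTau δ r σ n k) ↔
      TodaTau δ r σ 1 1 ∧ ∀ n k, 1 ≤ n → 1 ≤ k →
        TodaPhi δ r (fun i j => σ (i + 1) j * (σ i j)⁻¹ʳ)
          (fun i j => σ i (j + 1) * (σ i j)⁻¹ʳ) n k ∧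
        TodaPsi δ r (fun i j => σ (i + 1) j * (σ i j)⁻¹ʳ)
          (fun i j => σ i (j + 1) * (σ i j)⁻¹ʳ) n k := by
  set Φ : ℕ → ℕ → R := fun i j => σ (i + 1) j * (σ i j)⁻¹ʳ with hΦ
  set Ψ : ℕ → ℕ → R := fun i j => σ i (j + 1) * (σ i j)⁻¹ʳ with hΨ
  have hT : ∀ n k, TodaTau δ r σ (n + 1) (k + 1) ↔ ddlog δ r (σ (n + 1) (k + 1)) =
      Φ (n + 1) (k + 1) * (Φ n (k + 1))⁻¹ʳ - Ψ (n + 1) (k + 1) * (Ψ (n + 1) k)⁻¹ʳ :=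
    fun n k => todaTau_iff_ratio r (hσ _ _) (hσ _ _) rfl rfl rfl rfl
  have hdΦ : ∀ n k, ddlog δ r (Φ n k) = ddlog δ r (σ (n + 1) k) - ddlog δ r (σ n k) :=
    fun n k => ddlog_ratio r (hσ _ _) (hσ _ _)
  have hdΨ : ∀ n k, ddlog δ r (Ψ n k) = ddlog δ r (σ n (k + 1)) - ddlog δ r (σ n k) :=
    fun n k => ddlog_ratio r (hσ _ _) (hσ _ _)
  constructor
  · intro h
    refine ⟨h 1 1 le_rfl le_rfl, fun n k hn hk => ?_⟩
    obtain ⟨n, rfl⟩ := Nat.exists_eq_add_of_le' hn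
    obtain ⟨k, rfl⟩ := Nat.exists_eq_add_of_le' hk
    have h0 := (hT n k).mp (h _ _ hn hk)
    rw [todaPhi_iff, todaPsi_iff, hdΦ, hdΨ, h0,
      (hT (n + 1) k).mp (h _ _ (by omega) hk), (hT n (k + 1)).mp (h _ _ hn (by omega))]
    exact ⟨rfl, rfl⟩
  · rintro ⟨h0, h⟩ n k hn hk
    obtain ⟨n, rfl⟩ := Nat.exists_eq_add_of_le' hn
    obtain ⟨k, rfl⟩ := Nat.exists_eq_add_of_le' hk
    clear hn hk
    -- The coupled equations are differences of the Toda equation: the one for `Φ` carries it from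
    -- the corner along the first row, the one for `Ψ` then up each column.
    induction k with
    | zero =>
      induction n with
      | zero => exact h0
      | succ n ih =>
        have h1 := (todaPhi_iff r Φ Ψ n 0).mp (h (n + 1) (0 + 1) (by omega) (by omega)).1
        rw [hdΦ, (hT n 0).mp ih] at h1
        exact (hT (n + 1) 0).mpr (sub_left_inj.mp h1)
    | succ k ih =>
      have h1 := (todaPsi_iff r Φ Ψ n k).mp (h (n + 1) (k + 1) (by omega) (by omega)).2
      rw [hdΨ, (hT n k).mp ih] at h1
      exact (hT n (k + 1)).mpr (sub_left_inj.mp h1)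

end KP

/-! ### The Toda equations on the orbit. -/

theorem mainTheorem12 {R : Type*} [CommRing R] [Algebra ℚ R]
    (δ : ℕ+ → Derivation ℚ R R) (hδ : ∀ (i j : ℕ+) (f : R), δ i (δ j f) = δ j (δ i f))
    (r : ℕ+) (Ω : Set (ℕ × ℕ)) (hΩ : IsLowerSet Ω)
    (X : ℕ → ℕ → KP.Site δ 2) (S : ℕ → ℕ → Fin 2 → Fin 2 → R)
    (hX : KP.IsBinaryDBOrbit r 0 1 Ω X S)
    (τ Φ₁ Ψ₂ : ℕ → ℕ → R) (hτ : τ = fun n k => (X n k).τ)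
    (hΦ : Φ₁ = fun n k => (X n k).Φ 0) (hΨ : Ψ₂ = fun n k => (X n k).Ψ 1) :
    -- the tau-functions are invertible, and their second logarithmic derivative is `Res L`
    (∀ n k, (n, k) ∈ Ω → IsUnit (τ n k) ∧
      KP.ddlog δ r (τ n k) = PDO.res ((X n k).lax r) ∧
      PDO.res ((X n k).lax r) = (X n k).Φ 0 * (X n k).Ψ 0 + (X n k).Φ 1 * (X n k).Ψ 1) ∧
    (∀ n k, 1 ≤ n → 1 ≤ k → (n, k) ∈ Ω → KP.ddlog δ r (τ n k) =
      Φ₁ n k * (Φ₁ (n - 1) k)⁻¹ʳ - Ψ₂ n k * (Ψ₂ n (k - 1))⁻¹ʳ) ∧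
    -- the lattice fields are ratios of tau-functions
    (∀ n k, (n + 1, k) ∈ Ω → IsUnit (Φ₁ n k) ∧ Φ₁ n k = τ (n + 1) k * (τ n k)⁻¹ʳ) ∧
    (∀ n k, (n, k + 1) ∈ Ω → IsUnit (Ψ₂ n k) ∧ Ψ₂ n k = τ n (k + 1) * (τ n k)⁻¹ʳ) ∧
    -- the Toda square-lattice equation
    (∀ n k, 1 ≤ n → 1 ≤ k → (n + 1, k) ∈ Ω → (n, k + 1) ∈ Ω →
      KP.TodaTau δ r τ n k ∧ KP.TodaBilinear δ r τ n k) ∧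
    -- the coupled equations of motion
    (∀ n k, 1 ≤ n → 1 ≤ k → (n + 1, k) ∈ Ω → KP.TodaPhi δ r Φ₁ Ψ₂ n k) ∧
    (∀ n k, 1 ≤ n → 1 ≤ k → (n, k + 1) ∈ Ω → KP.TodaPsi δ r Φ₁ Ψ₂ n k) ∧
    -- equivalence of the three forms for an arbitrary lattice of invertible functions
    (∀ σ : ℕ → ℕ → R, (∀ n k, IsUnit (σ n k)) →
      (∀ n k, 1 ≤ n → 1 ≤ k → (KP.TodaTau δ r σ n k ↔ KP.TodaBilinear δ r σ n k)) ∧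
      ((∀ n k, 1 ≤ n → 1 ≤ k → KP.TodaTau δ r σ n k) ↔
        KP.TodaTau δ r σ 1 1 ∧ ∀ n k, 1 ≤ n → 1 ≤ k →
          KP.TodaPhi δ r (fun i j => σ (i + 1) j * (σ i j)⁻¹ʳ)
            (fun i j => σ i (j + 1) * (σ i j)⁻¹ʳ) n k ∧
          KP.TodaPsi δ r (fun i j => σ (i + 1) j * (σ i j)⁻¹ʳ)
            (fun i j => σ i (j + 1) * (σ i j)⁻¹ʳ) n k)) := by
  have hlow : ∀ {n k n' k'}, n' ≤ n → k' ≤ k → (n, k) ∈ Ω → (n', k') ∈ Ω := fun h1 h2 h =>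
    hΩ (Prod.mk_le_mk.mpr ⟨h1, h2⟩) h
  have hsol := hX.isDressedCKP hδ hΩ
  have hu : ∀ n k, (n, k) ∈ Ω → IsUnit (τ n k) := fun n k h => by
    rw [hτ]; exact (hsol n k h).isUnit_tau
  have hres : ∀ n k, (n, k) ∈ Ω → PDO.res ((X n k).lax r) =
      (X n k).Φ 0 * (X n k).Ψ 0 + (X n k).Φ 1 * (X n k).Ψ 1 := fun n k h => by
    rw [(hsol n k h).res_lax, Fin.sum_univ_two]
  have hdd : ∀ n k, (n, k) ∈ Ω → KP.ddlog δ r (τ n k) = PDO.res ((X n k).lax r) :=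
    fun n k h => by rw [hτ]; exact (hsol n k h).ddlog_tau hδ
  -- Both steps entering the site are used: the DB step from `(n, k + 1)` fixes `Ψ 0`, and the
  -- adjoint step from `(n + 1, k)` fixes `Φ 1`.
  have hE : ∀ n k, (n + 1, k + 1) ∈ Ω → KP.ddlog δ r (τ (n + 1) (k + 1)) =
      Φ₁ (n + 1) (k + 1) * (Φ₁ n (k + 1))⁻¹ʳ - Ψ₂ (n + 1) (k + 1) * (Ψ₂ (n + 1) k)⁻¹ʳ := by
    intro n k h
    rw [hdd _ _ h, hres _ _ h, (hX.step n (k + 1) h).psi_self, (hX.adj_step (n + 1) k h).phi_self,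
      hΦ, hΨ]
    ring
  have hΦu : ∀ n k, (n + 1, k) ∈ Ω → IsUnit (Φ₁ n k) := fun n k h => by
    rw [hΦ]; exact (hX.step n k h).isUnit
  have hΨu : ∀ n k, (n, k + 1) ∈ Ω → IsUnit (Ψ₂ n k) := fun n k h => by
    rw [hΨ]; exact (hX.adj_step n k h).isUnit
  have hΦτ : ∀ n k, (n + 1, k) ∈ Ω → τ (n + 1) k = Φ₁ n k * τ n k := fun n k h => by
    rw [hΦ, hτ]; exact (hX.step n k h).tau_eq
  have hΨτ : ∀ n k, (n, k + 1) ∈ Ω → τ n (k + 1) = Ψ₂ n k * τ n k := fun n k h => by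
    rw [hΨ, hτ]; exact (hX.adj_step n k h).tau_eq
  have hΦr : ∀ n k, (n + 1, k) ∈ Ω → Φ₁ n k = τ (n + 1) k * (τ n k)⁻¹ʳ := fun n k h => by
    rw [hΦτ n k h, Ring.mul_inverse_cancel_right _ _ (hu n k (hlow (by omega) le_rfl h))]
  have hΨr : ∀ n k, (n, k + 1) ∈ Ω → Ψ₂ n k = τ n (k + 1) * (τ n k)⁻¹ʳ := fun n k h => by
    rw [hΨτ n k h, Ring.mul_inverse_cancel_right _ _ (hu n k (hlow le_rfl (by omega) h))]
  refine ⟨fun n k h => ⟨hu n k h, hdd n k h, hres n k h⟩, fun n k hn hk h => ?_,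
    fun n k h => ⟨hΦu n k h, hΦr n k h⟩, fun n k h => ⟨hΨu n k h, hΨr n k h⟩,
    fun n k hn hk h h' => ?_, fun n k hn hk h => ?_, fun n k hn hk h => ?_, fun σ hσ =>
      ⟨fun n k _ _ => KP.todaTau_iff_todaBilinear r σ n k (hσ n k), KP.todaTau_iff_coupled r hσ⟩⟩
  all_goals
    obtain ⟨n, rfl⟩ := Nat.exists_eq_add_of_le' hn
    obtain ⟨k, rfl⟩ := Nat.exists_eq_add_of_le' hk
  · exact hE n k h
  · have h0 : (n + 1, k + 1) ∈ Ω := hlow (by omega) le_rfl h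
    have hT : KP.TodaTau δ r τ (n + 1) (k + 1) :=
      (KP.todaTau_iff_ratio r (hu _ _ (hlow (by omega) le_rfl h0))
        (hu _ _ (hlow le_rfl (by omega) h0)) (hΦr _ _ h) (hΦr _ _ h0) (hΨr _ _ h')
        (hΨr _ _ h0)).mpr (hE n k h0)
    exact ⟨hT, (KP.todaTau_iff_todaBilinear r τ _ _ (hu _ _ h0)).mp hT⟩
  · have h0 : (n + 1, k + 1) ∈ Ω := hlow (by omega) le_rfl h
    -- The relation `hE` needs no site beyond its own, so the fields there may fail to be invertible
    -- and `(n + 2, k + 1) ∈ Ω` is enough.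
    rw [KP.todaPhi_iff, ← hE n k h0, ← hE (n + 1) k h, hΦτ (n + 1) (k + 1) h,
      KP.ddlog_mul r (hΦu _ _ h) (hu _ _ h0), add_sub_cancel_right]
  · have h0 : (n + 1, k + 1) ∈ Ω := hlow le_rfl (by omega) h
    rw [KP.todaPsi_iff, ← hE n k h0, ← hE n (k + 1) h, hΨτ (n + 1) (k + 1) h,
      KP.ddlog_mul r (hΨu _ _ h) (hu _ _ h0), add_sub_cancel_right]
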